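/- Let $R$ be a commutative integral domain with identity, equipped with an involutive ring automorphism $r\mapsto r^*$ (possibly the identity), and let $\Gamma$ be a discrete group with identity $e$. For $i=1,2$ let $\mathcal{G}_i$ be an ample Hausdorff groupoid (a topological groupoid that is Hausdorff, whose range and source maps $r,s:\mathcal{G}_i\to\mathcal{G}_i^0$ are local homeomorphisms, and whose unit space $\mathcal{G}_i^0$ has a basis of compact open sets), and let $c_i:\mathcal{G}_i\to\Gamma$ be a continuous cocycle (that is, a continuous homomorphism). Suppose that for $i=1,2$ there is a dense subset $X_i\subseteq\mathcal{G}_i^0$ such that for every $x\in X_i$ the group-ring over $R$ of the group $\{\eta\in\mathcal{G}_i: s(\eta)=r(\eta)=x,\ c_i(\eta)=e\}$ has no zero-divisors and only trivial units (every unit is of the form $uh$ with $u\in R$ and $h$ in the group). Let $\mathcal{R}$ be the full countable equivalence relation $\mathbb{N}\times\mathbb{N}$, regarded as a discrete principal groupoid with unit space $\mathbb{N}$, and let $\bar{c}_i:\mathcal{G}_i\times\mathcal{R}\to\Gamma$ be the cocycle $\bar{c}_i(\eta,\xi)=c_i(\eta)$. Let $A_R(\mathcal{G}_i)$ be the Steinberg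 algebra, i.e. the $*$-algebra of locally constant compactly supported functions $\mathcal{G}_i\to R$ with the convolution product $(f*g)(\eta)=\sum_{\alpha\beta=\eta}f(\alpha)g(\beta)$ and the involution $f^*(\eta)=f(\eta^{-1})^*$. Let $D_R(\mathcal{G}_i)$ be the subalgebra of those $f\in A_R(\mathcal{G}_i)$ that vanish outside $\mathcal{G}_i^0$, and for $g\in\Gamma$ let $A_R(\mathcal{G}_i)_g=\{f\in A_R(\mathcal{G}_i):\operatorname{supp}(f)\subseteq c_i^{-1}(g)\}$. Let $M_\infty(R)$ be the $*$-algebra of $\mathbb{N}\times\mathbb{N}$-matrices over $R$ with finitely many non-zero entries (the involution being conjugate transposition) and $D_\infty(R)$ its subalgebra of diagonal matrices. All tensor products are over $R$. A bijection $\phi:A_R(\mathcal{G}_1)\otimes M_\infty(R)\to A_R(\mathcal{G}_2)\otimes M_\infty(R)$ is called diagonal-preserving if $\phi(D_R(\mathcal{G}_1)\otimes D_\infty(R))=D_R(\mathcal{G}_2)\otimes D_\infty(R)$, and graded if $\phi(A_R(\mathcal{G}_1)_g\otimes M_\infty(R))=A_R(\mathcal{G}_2)_g\otimes M_\infty(R)$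 for every $g\in\Gamma$. Then the following are equivalent. 1. There is an isomorphism of topological groupoids $\psi:\mathcal{G}_1\times\mathcal{R}\to\mathcal{G}_2\times\mathcal{R}$ such that $\bar{c}_2\circ\psi=\bar{c}_1$. 2. There is a diagonal-preserving graded $*$-algebra-isomorphism (in particular, $R$-linear) from $A_R(\mathcal{G}_1)\otimes M_\infty(R)$ to $A_R(\mathcal{G}_2)\otimes M_\infty(R)$. 3. There is a diagonal-preserving graded ring-isomorphism (not necessarily $R$-linear) from $A_R(\mathcal{G}_1)\otimes M_\infty(R)$ to $A_R(\mathcal{G}_2)\otimes M_\infty(R)$. -/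

import Mathlib

open scoped TensorProduct Topology

namespace SteinbergStable

/-! ## Groupoids -/

/-- A groupoid (a small category with inverses), presented by its set `G` of morphisms: `src` and
`rng` send a morphism to the identity morphisms at its source and range, and `comp a b` is the
composite, defined only if `src a = rng b`. -/
class GroupoidStr (G : Type*) where
  src : G → G
  rng : G → G
  inv : G → G
  comp : (a b : G) → src a = rng b → G
  rng_src : ∀ a, rng (src a) = src a
  src_rng : ∀ a, src (rng a) = rng a
  src_comp : ∀ a b h, src (comp a b h) = src b
  rng_comp : ∀ a b h, rng (comp a b h) = rng a
  comp_assoc : ∀ (a b d : G) (h : src a = rng b) (h' : src b = rng d),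
    comp (comp a b h) d ((src_comp a b h).trans h') =
      comp a (comp b d h') (h.trans (rng_comp b d h').symm)
  comp_src : ∀ a, comp a (src a) (rng_src a).symm = a
  rng_comp_self : ∀ a, comp (rng a) a (src_rng a) = a
  src_inv : ∀ a, src (inv a) = rng a
  rng_inv : ∀ a, rng (inv a) = src a
  comp_inv : ∀ a, comp a (inv a) (rng_inv a).symm = rng a
  inv_comp : ∀ a, comp (inv a) a (src_inv a) = src a

open GroupoidStr

section Algebra

variable {G : Type*} [GroupoidStr G]

theorem src_src (a : G) : src (src a) = src a := by
  have h := src_rng (src a)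
  rwa [rng_src] at h

theorem rng_rng (a : G) : rng (rng a) = rng a := by
  have h := rng_src (rng a)
  rwa [src_rng] at h

theorem comp_congr {a a' b b' : G} (ha : a = a') (hb : b = b') (h : src a = rng b) :
    comp a b h = comp a' b' (ha ▸ hb ▸ h) := by
  subst ha; subst hb; rfl

theorem inv_comp_cancel (a b : G) (h : src a = rng b) :
    comp (inv a) (comp a b h) ((src_inv a).trans (rng_comp a b h).symm) = b := by
  rw [← comp_assoc (inv a) a b (src_inv a) h,
    comp_congr (inv_comp a) rfl ((src_comp _ _ _).trans h),
    comp_congr h rfl, rng_comp_self]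

theorem comp_inv_cancel (a b : G) (h : rng a = rng b) :
    comp a (comp (inv a) b ((src_inv a).trans h)) ((rng_inv a).symm.trans (rng_comp _ _ _).symm)
      = b := by
  rw [← comp_assoc a (inv a) b (rng_inv a).symm ((src_inv a).trans h),
    comp_congr (comp_inv a) rfl ((src_comp _ _ _).trans ((src_inv a).trans h)),
    comp_congr h rfl, rng_comp_self]

theorem comp_left_cancel {a b b' : G} (h : src a = rng b) (h' : src a = rng b')
    (e : comp a b h = comp a b' h') : b = b' := by
  rw [← inv_comp_cancel a b h, ← inv_comp_cancel a b' h']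
  exact comp_congr rfl e _

theorem eq_inv_of_comp {a b : G} (h : src a = rng b) (e : comp a b h = rng a) : b = inv a :=
  comp_left_cancel h (rng_inv a).symm (e.trans (comp_inv a).symm)

theorem inv_inv' (a : G) : inv (inv a) = a :=
  (eq_inv_of_comp (src_inv a) ((inv_comp a).trans (rng_inv a).symm)).symm

theorem inv_comp_rev (a b : G) (h : src a = rng b) :
    inv (comp a b h) = comp (inv b) (inv a) ((src_inv b).trans (h.symm.trans (rng_inv a).symm)) := by
  have h1 : src (comp a b h) = rng (comp (inv b) (inv a)
      ((src_inv b).trans (h.symm.trans (rng_inv a).symm))) := by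
    rw [src_comp, rng_comp, rng_inv]
  refine (eq_inv_of_comp h1 ?_).symm
  have h2 : rng b = rng (inv a) := h.symm.trans (rng_inv a).symm
  rw [rng_comp, comp_assoc a b _ h ((rng_inv b).symm.trans (rng_comp _ _ _).symm),
    comp_congr rfl (comp_inv_cancel b (inv a) h2), comp_inv]

end Algebra

/-- The unit space `G⁰`, as a subset of `G`. -/
def units (G : Type*) [GroupoidStr G] : Set G := Set.range (rng : G → G)

/-- The source map, as a map to the unit space. -/
def srcUnit {G : Type*} [GroupoidStr G] (a : G) : units G := ⟨src a, src a, rng_src a⟩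

/-- The range map, as a map to the unit space. -/
def rngUnit {G : Type*} [GroupoidStr G] (a : G) : units G := ⟨rng a, a, rfl⟩

/-- The set `G²` of composable pairs. -/
abbrev Composable (G : Type*) [GroupoidStr G] : Type _ := {p : G × G // src p.1 = rng p.2}

/-- Composition, as a map `G² → G`. -/
def compPair {G : Type*} [GroupoidStr G] (p : Composable G) : G := comp p.1.1 p.1.2 p.2

/-- Hausdorff topological groupoids. -/
class IsHausdorffGroupoid (G : Type*) [GroupoidStr G] [TopologicalSpace G] : Prop where
  t2 : T2Space G
  continuous_src : Continuous (src : G → G)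
  continuous_rng : Continuous (rng : G → G)
  continuous_inv : Continuous (inv : G → G)
  continuous_comp : Continuous (compPair : Composable G → G)

/-- Étale Hausdorff groupoids: source and range are local homeomorphisms onto the unit space. -/
class IsEtaleGroupoid (G : Type*) [GroupoidStr G] [TopologicalSpace G] : Prop extends
    IsHausdorffGroupoid G where
  src_localHomeo : IsLocalHomeomorph (srcUnit : G → units G)
  rng_localHomeo : IsLocalHomeomorph (rngUnit : G → units G)

/-- Ample Hausdorff groupoids: étale, and the unit space has a basis of compact open sets. -/
class IsAmpleGroupoid (G : Type*) [GroupoidStr G] [TopologicalSpace G] : Prop extends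
    IsEtaleGroupoid G where
  basis_compactOpen : TopologicalSpace.IsTopologicalBasis
    {U : Set (units G) | IsCompact U ∧ IsOpen U}

/-- Isomorphisms of topological groupoids. -/
structure GroupoidIso (G H : Type*) [GroupoidStr G] [TopologicalSpace G] [GroupoidStr H]
    [TopologicalSpace H] extends G ≃ₜ H where
  map_src : ∀ a, toFun (src a) = src (toFun a)
  map_rng : ∀ a, toFun (rng a) = rng (toFun a)
  map_comp : ∀ a b (h : src a = rng b), toFun (comp a b h) =
    comp (toFun a) (toFun b) ((map_src a).symm.trans ((congrArg toFun h).trans (map_rng b)))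

/-- Continuous cocycles on `G`, i.e. continuous homomorphisms to the (discrete) group `Γ`. -/
structure ContCocycle (G Γ : Type*) [GroupoidStr G] [TopologicalSpace G] [Group Γ]
    [TopologicalSpace Γ] where
  toFun : G → Γ
  continuous_toFun : Continuous toFun
  map_comp : ∀ a b (h : src a = rng b), toFun (comp a b h) = toFun a * toFun b

namespace ContCocycle

variable {G Γ : Type*} [GroupoidStr G] [TopologicalSpace G] [Group Γ] [TopologicalSpace Γ]

theorem map_unit (c : ContCocycle G Γ) (x : G) : c.toFun (rng x) = 1 := by
  have h := c.map_comp (rng x) (rng x) ((src_rng x).trans (rng_rng x).symm)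
  have h2 : comp (rng x) (rng x) ((src_rng x).trans (rng_rng x).symm) = rng x := by
    rw [comp_congr (rng_rng x).symm rfl, rng_comp_self]
  rw [h2] at h
  exact left_eq_mul.mp h

theorem map_inv (c : ContCocycle G Γ) (x : G) : c.toFun (inv x) = (c.toFun x)⁻¹ := by
  have h := c.map_comp x (inv x) (rng_inv x).symm
  rw [comp_inv, map_unit] at h
  exact (inv_eq_of_mul_eq_one_right h.symm).symm

/-- The group `c⁻¹(e) ∩ Gₓˣ` of isotropy elements at `x` in the kernel of the cocycle. -/
def IsotropyKernel (c : ContCocycle G Γ) (x : units G) : Type _ :=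
  {a : G // src a = x ∧ rng a = x ∧ c.toFun a = 1}

instance (c : ContCocycle G Γ) (x : units G) : Group (c.IsotropyKernel x) where
  mul a b := ⟨comp a.1 b.1 (a.2.1.trans b.2.2.1.symm), (src_comp _ _ _).trans b.2.1,
    (rng_comp _ _ _).trans a.2.2.1, by rw [c.map_comp, a.2.2.2, b.2.2.2, one_mul]⟩
  one := ⟨x.1, by obtain ⟨_, y, rfl⟩ := x; exact src_rng y,
    by obtain ⟨_, y, rfl⟩ := x; exact rng_rng y, by obtain ⟨_, y, rfl⟩ := x; exact c.map_unit y⟩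
  inv a := ⟨inv a.1, (src_inv _).trans a.2.2.1, (rng_inv _).trans a.2.1, by
    rw [c.map_inv, a.2.2.2, inv_one]⟩
  mul_assoc a b d := Subtype.ext (comp_assoc a.1 b.1 d.1 _ _)
  one_mul a := Subtype.ext ((comp_congr a.2.2.1.symm rfl _).trans (rng_comp_self a.1))
  mul_one a := Subtype.ext ((comp_congr rfl a.2.1.symm _).trans (comp_src a.1))
  inv_mul_cancel a := Subtype.ext ((inv_comp a.1).trans a.2.1)

end ContCocycle

/-- The group-ring `RH` has no zero-divisors and only trivial units, i.e. every unit of `RH` is of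
the form `u h` with `u ∈ R` and `h ∈ H`. -/
def GoodGroupRing (R H : Type*) [CommRing R] [Group H] : Prop :=
  NoZeroDivisors (MonoidAlgebra R H) ∧
    ∀ a : MonoidAlgebra R H, IsUnit a → ∃ (u : R) (h : H), a = MonoidAlgebra.single h u

/-- The condition that there is a dense set `X` of units such that the group-ring of
`c⁻¹(e) ∩ Gₓˣ` has no zero-divisors and only trivial units, for all `x ∈ X`. -/
def InClass (R : Type*) {G Γ : Type*} [CommRing R] [GroupoidStr G] [TopologicalSpace G] [Group Γ]
    [TopologicalSpace Γ] (c : ContCocycle G Γ) : Prop :=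
  ∃ X : Set (units G), Dense X ∧ ∀ x ∈ X, GoodGroupRing R (c.IsotropyKernel x)

/-! ## Products with the full countable equivalence relation -/

instance prodGroupoid {G H : Type*} [GroupoidStr G] [GroupoidStr H] : GroupoidStr (G × H) where
  src a := (src a.1, src a.2)
  rng a := (rng a.1, rng a.2)
  inv a := (inv a.1, inv a.2)
  comp a b h := (comp a.1 b.1 (congrArg Prod.fst h), comp a.2 b.2 (congrArg Prod.snd h))
  rng_src _ := Prod.ext (rng_src _) (rng_src _)
  src_rng _ := Prod.ext (src_rng _) (src_rng _)
  src_comp _ _ _ := Prod.ext (src_comp _ _ _) (src_comp _ _ _)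
  rng_comp _ _ _ := Prod.ext (rng_comp _ _ _) (rng_comp _ _ _)
  comp_assoc _ _ _ _ _ := Prod.ext (comp_assoc _ _ _ _ _) (comp_assoc _ _ _ _ _)
  comp_src _ := Prod.ext (comp_src _) (comp_src _)
  rng_comp_self _ := Prod.ext (rng_comp_self _) (rng_comp_self _)
  src_inv _ := Prod.ext (src_inv _) (src_inv _)
  rng_inv _ := Prod.ext (rng_inv _) (rng_inv _)
  comp_inv _ := Prod.ext (comp_inv _) (comp_inv _)
  inv_comp _ := Prod.ext (inv_comp _) (inv_comp _)

/-- The full countable equivalence relation `ℕ × ℕ`. -/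
def FullRel : Type := ℕ × ℕ

instance : TopologicalSpace FullRel := ⊥

instance : DiscreteTopology FullRel := ⟨rfl⟩

instance : GroupoidStr FullRel where
  src a := (a.2, a.2)
  rng a := (a.1, a.1)
  inv a := (a.2, a.1)
  comp a b _ := (a.1, b.2)
  rng_src _ := rfl
  src_rng _ := rfl
  src_comp _ _ _ := rfl
  rng_comp _ _ _ := rfl
  comp_assoc _ _ _ _ _ := rfl
  comp_src _ := rfl
  rng_comp_self _ := rfl
  src_inv _ := rfl
  rng_inv _ := rfl
  comp_inv _ := rfl
  inv_comp _ := rfl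

/-- The cocycle `(η, ξ) ↦ c(η)` on `G × ℛ`. -/
def ContCocycle.stab {G Γ : Type*} [GroupoidStr G] [TopologicalSpace G] [Group Γ]
    [TopologicalSpace Γ] (c : ContCocycle G Γ) : ContCocycle (G × FullRel) Γ where
  toFun p := c.toFun p.1
  continuous_toFun := c.continuous_toFun.comp continuous_fst
  map_comp _ _ h := c.map_comp _ _ (congrArg Prod.fst h)

/-! ## Steinberg algebras -/

theorem isClosed_support {R G : Type*} [CommRing R] [TopologicalSpace G] {f : G → R}
    (hf : IsLocallyConstant f) : IsClosed (Function.support f) :=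
  (hf.isOpen_fiber 0).isClosed_compl

section Steinberg

variable {R G : Type*} [CommRing R] [TopologicalSpace G]

variable (R G) in
/-- The `R`-module of locally constant functions `G → R` with compact support, which underlies
the Steinberg algebra. -/
def steinbergModule : Submodule R (G → R) where
  carrier := {f | IsLocallyConstant f ∧ IsCompact (Function.support f)}
  zero_mem' := ⟨IsLocallyConstant.const 0, by simp⟩
  add_mem' {f g} hf hg := ⟨hf.1.add hg.1, (hf.2.union hg.2).of_isClosed_subset
    (isClosed_support (hf.1.add hg.1)) (Function.support_add f g)⟩
  smul_mem' r f hf :=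
    have h : IsLocallyConstant (r • f) := hf.1.comp (fun y => r * y)
    ⟨h, hf.2.of_isClosed_subset (isClosed_support h) (Function.support_const_smul_subset r f)⟩

variable (R G) in
/-- The Steinberg algebra `A_R(G)`. -/
def Steinberg : Type _ := steinbergModule R G

namespace Steinberg

noncomputable instance : AddCommGroup (Steinberg R G) :=
  inferInstanceAs (AddCommGroup (steinbergModule R G))

noncomputable instance : Module R (Steinberg R G) :=
  inferInstanceAs (Module R (steinbergModule R G))

instance : CoeFun (Steinberg R G) (fun _ => G → R) := ⟨fun f => f.1⟩

theorem ext {f g : Steinberg R G} (h : ∀ a, f a = g a) : f = g := Subtype.ext (funext h)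

@[simp] theorem add_apply (f g : Steinberg R G) (a : G) : (f + g) a = f a + g a := rfl
@[simp] theorem zero_apply (a : G) : (0 : Steinberg R G) a = 0 := rfl
@[simp] theorem smul_apply (r : R) (f : Steinberg R G) (a : G) : (r • f) a = r * f a := rfl

end Steinberg

/-- The convolution product `(f * g)(η) = ∑_{αβ = η} f(α) g(β)`. -/
noncomputable def conv [GroupoidStr G] (f g : G → R) (η : G) : R :=
  ∑ᶠ p ∈ {p : Composable G | compPair p = η}, f p.1.1 * g p.1.2

end Steinberg

/-! ### Sums along the fibres of a map

The facts needed to see that the convolution of two elements of the Steinberg algebra is again an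
element of the Steinberg algebra, and that convolution is associative. -/

section Fibre

variable {E B C M : Type*} [AddCommMonoid M]

theorem finite_fibre [TopologicalSpace E] [TopologicalSpace B] [T1Space B] {p : E → B}
    (hp : Continuous p) (hinj : IsLocallyInjective p) {K : Set E} (hK : IsCompact K) (b : B) :
    {e | e ∈ K ∧ p e = b}.Finite := by
  have hc : IsCompact {e | e ∈ K ∧ p e = b} :=
    hK.inter_right (isClosed_singleton.preimage hp)
  refine hc.finite (isDiscrete_iff_discreteTopology.mpr ?_)
  rw [discreteTopology_subtype_iff']
  rintro e ⟨heK, rfl⟩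
  obtain ⟨U, hU, heU, hUi⟩ := hinj e
  refine ⟨U, hU, ?_⟩
  ext e'
  constructor
  · rintro ⟨h1, -, h2⟩
    exact hUi h1 heU h2
  · rintro rfl
    exact ⟨heU, heK, rfl⟩

theorem isLocallyConstant_fibreSum [TopologicalSpace E] [TopologicalSpace B] [T2Space E]
    [T2Space B] {p : E → B} (hp : Continuous p) (hopen : IsOpenMap p)
    (hinj : IsLocallyInjective p) {F : E → M} (hF : IsLocallyConstant F)
    (hK : IsCompact (Function.support F)) :
    IsLocallyConstant (fun b => ∑ᶠ e ∈ {e | p e = b}, F e) := by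
  rw [IsLocallyConstant.iff_eventually_eq]
  intro b
  set T : Set E := {e | e ∈ Function.support F ∧ p e = b} with hT
  have hTfin : T.Finite := finite_fibre hp hinj hK b
  obtain ⟨V, hV, hVd⟩ := hTfin.t2_separation
  choose U hUo hUe hUi using hinj
  set W : E → Set E := fun e => V e ∩ U e ∩ {e' | F e' = F e} with hW
  have hWo : ∀ e, IsOpen (W e) := fun e =>
    ((hV e).2.inter (hUo e)).inter (hF.isOpen_fiber _)
  have hWe : ∀ e, e ∈ W e := fun e => ⟨⟨(hV e).1, hUe e⟩, rfl⟩
  set K : Set E := Function.support F \ ⋃ e ∈ T, W e with hKdef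
  have hKc : IsCompact K := hK.diff (isOpen_biUnion fun e _ => hWo e)
  have hbK : b ∉ p '' K := by
    rintro ⟨e, ⟨he, heW⟩, rfl⟩
    exact heW (Set.mem_biUnion (show e ∈ T from ⟨he, rfl⟩) (hWe e))
  have h1 : ∀ᶠ x in 𝓝 b, x ∉ p '' K :=
    (hKc.image hp).isClosed.isOpen_compl.mem_nhds hbK
  have h2 : ∀ᶠ x in 𝓝 b, ∀ e ∈ T, x ∈ p '' W e := by
    rw [Filter.eventually_all_finite hTfin]
    rintro e ⟨-, rfl⟩
    exact (hopen _ (hWo e)).mem_nhds ⟨e, hWe e, rfl⟩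
  filter_upwards [h1, h2] with x hx1 hx2
  have hs : ∀ e, ∃ e', e ∈ T → e' ∈ W e ∧ p e' = x := by
    intro e
    by_cases he : e ∈ T
    · obtain ⟨e', h, h'⟩ := hx2 e he
      exact ⟨e', fun _ => ⟨h, h'⟩⟩
    · exact ⟨e, fun h => absurd h he⟩
  choose s hs using hs
  have hsi : Set.InjOn s T := by
    intro e he e' he' h
    by_contra hne
    exact Set.disjoint_left.mp (hVd he he' hne) (hs e he).1.1.1 (h ▸ (hs e' he').1.1.1)
  have e1 : ∑ᶠ e ∈ {e | p e = x}, F e = ∑ᶠ e ∈ s '' T, F e := by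
    refine finsum_mem_inter_support_eq' _ _ _ fun e he => ⟨fun hpe => ?_, ?_⟩
    · have : e ∈ ⋃ e ∈ T, W e := by
        by_contra hcon
        exact hx1 ⟨e, ⟨he, hcon⟩, hpe⟩
      obtain ⟨e', he', heW⟩ := Set.mem_iUnion₂.mp this
      exact ⟨e', he', hUi e' (hs e' he').1.1.2 heW.1.2 ((hs e' he').2.trans hpe.symm)⟩
    · rintro ⟨e', he', rfl⟩
      exact (hs e' he').2
  have e2 : ∑ᶠ e ∈ {e | p e = b}, F e = ∑ᶠ e ∈ T, F e :=
    finsum_mem_inter_support_eq' _ _ _ fun e he => ⟨fun h => ⟨he, h⟩, fun h => h.2⟩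
  refine e1.trans (Eq.trans ?_ e2.symm)
  rw [finsum_mem_image hsi]
  exact finsum_mem_congr rfl fun e he => (hs e he).1.2

theorem finsum_fibre_fibre {p : E → B} {q : B → C} {F : E → M} {c : C}
    (hfin : {e | q (p e) = c ∧ F e ≠ 0}.Finite) :
    ∑ᶠ b ∈ {b | q b = c}, ∑ᶠ e ∈ {e | p e = b}, F e = ∑ᶠ e ∈ {e | q (p e) = c}, F e := by
  set S : Set E := {e | q (p e) = c ∧ F e ≠ 0} with hS
  have hU : S = ⋃ b ∈ p '' S, (S ∩ {e | p e = b}) := by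
    ext e
    simp only [Set.mem_iUnion, Set.mem_inter_iff, Set.mem_ofPred_eq, exists_prop]
    exact ⟨fun h => ⟨p e, ⟨e, h, rfl⟩, h, rfl⟩, fun ⟨_, _, h, _⟩ => h⟩
  have e1 : ∑ᶠ e ∈ {e | q (p e) = c}, F e = ∑ᶠ e ∈ S, F e :=
    finsum_mem_inter_support_eq' _ _ _ fun e he => ⟨fun h => ⟨h, he⟩, fun h => h.1⟩
  have e3 : ∀ b, q b = c → ∑ᶠ e ∈ {e | p e = b}, F e = ∑ᶠ e ∈ S ∩ {e | p e = b}, F e := by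
    rintro b rfl
    exact finsum_mem_inter_support_eq' _ _ _ fun e he =>
      ⟨fun h => ⟨⟨congrArg q h, he⟩, h⟩, fun h => h.2⟩
  rw [e1, finsum_mem_congr (s := {b | q b = c}) rfl e3, hU, finsum_mem_biUnion, ← hU]
  · refine finsum_mem_inter_support_eq' _ _ _ fun b hb => ⟨fun _ => ?_, ?_⟩
    · by_contra hcon
      refine hb (finsum_mem_eq_zero_of_forall_eq_zero ?_)
      rintro e ⟨he, rfl⟩
      exact absurd ⟨e, he, rfl⟩ hcon
    · rintro ⟨e, he, rfl⟩
      exact he.1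
  · intro b _ b' _ hne
    refine Set.disjoint_left.mpr ?_
    rintro e ⟨-, rfl⟩ ⟨-, h⟩
    exact hne h
  · exact hfin.image p
  · exact fun b _ => hfin.inter_of_left _

end Fibre

/-! ### Composition is a local homeomorphism -/

section Etale

variable {G : Type*} [GroupoidStr G] [TopologicalSpace G]

theorem isClosed_composable [IsHausdorffGroupoid G] :
    IsClosed {p : G × G | src p.1 = rng p.2} :=
  have := IsHausdorffGroupoid.t2 (G := G)
  isClosed_eq (IsHausdorffGroupoid.continuous_src.comp continuous_fst)
    (IsHausdorffGroupoid.continuous_rng.comp continuous_snd)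

theorem isCompact_composable [IsHausdorffGroupoid G] {K L : Set G} (hK : IsCompact K)
    (hL : IsCompact L) : IsCompact {p : Composable G | p.1.1 ∈ K ∧ p.1.2 ∈ L} :=
  (isClosed_composable (G := G)).isClosedEmbedding_subtypeVal.isCompact_preimage (hK.prod hL)

theorem isLocallyInjective_compPair [IsEtaleGroupoid G] :
    IsLocallyInjective (compPair : Composable G → G) := by
  intro p
  obtain ⟨U, hU, hpU, hUi⟩ :=
    (IsEtaleGroupoid.rng_localHomeo (G := G)).isLocallyInjective p.1.1
  refine ⟨{q | q.1.1 ∈ U}, hU.preimage (continuous_fst.comp continuous_subtype_val), hpU, ?_⟩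
  rintro ⟨⟨a, b⟩, h⟩ ha ⟨⟨a', b'⟩, h'⟩ ha' e
  have e' : comp a b h = comp a' b' h' := e
  have hr : rng a = rng a' := by rw [← rng_comp a b h, e', rng_comp]
  obtain rfl : a = a' := hUi ha ha' (Subtype.ext hr)
  obtain rfl : b = b' := comp_left_cancel h h' e'
  rfl

theorem isOpenMap_compPair [IsEtaleGroupoid G] :
    IsOpenMap (compPair : Composable G → G) := by
  intro N hN
  rw [isOpen_iff_mem_nhds]
  rintro _ ⟨p, hp, rfl⟩
  -- the inverse of the shear map `(a, b) ↦ (a, ab)`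
  let Q : Type _ := {q : G × G // rng q.1 = rng q.2}
  let i : Q → Composable G := fun q =>
    ⟨(inv q.1.1, q.1.2), (src_inv q.1.1).trans q.2⟩
  have hi : Continuous i := Continuous.subtype_mk
    ((IsHausdorffGroupoid.continuous_inv.comp (continuous_fst.comp continuous_subtype_val)).prodMk
      (continuous_snd.comp continuous_subtype_val)) _
  let φ : Q → Composable G := fun q =>
    ⟨(q.1.1, compPair (i q)), (rng_inv q.1.1).symm.trans (rng_comp _ _ _).symm⟩
  have hφ : Continuous φ := Continuous.subtype_mk
    ((continuous_fst.comp continuous_subtype_val).prodMk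
      (IsHausdorffGroupoid.continuous_comp.comp hi)) _
  let q₀ : Q := ⟨(p.1.1, compPair p), (rng_comp _ _ _).symm⟩
  have hq₀ : φ q₀ = p := Subtype.ext (Prod.ext rfl (inv_comp_cancel p.1.1 p.1.2 p.2))
  have hn : φ ⁻¹' N ∈ 𝓝 q₀ := (hN.preimage hφ).mem_nhds (by rw [Set.mem_preimage, hq₀]; exact hp)
  obtain ⟨t, ht, htN⟩ := (mem_nhds_induced (Subtype.val : Q → G × G) q₀ _).mp hn
  rw [nhds_prod_eq] at ht
  obtain ⟨A, hA, D, hD, hAD⟩ := Filter.mem_prod_iff.mp ht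
  have hr : rngUnit '' A ∈ 𝓝 (rngUnit (compPair p)) := by
    have h := (IsEtaleGroupoid.rng_localHomeo (G := G)).map_nhds_eq p.1.1
    have h' : rngUnit (compPair p) = rngUnit p.1.1 := Subtype.ext (rng_comp _ _ _)
    rw [h', ← h]
    exact Filter.image_mem_map hA
  have hc := (IsEtaleGroupoid.rng_localHomeo (G := G)).continuous.continuousAt hr
  filter_upwards [hD, hc] with η hη hη'
  obtain ⟨a, ha, hae⟩ := hη'
  have hae' : rng a = rng η := congrArg Subtype.val hae
  exact ⟨φ ⟨(a, η), hae'⟩, htN (hAD ⟨ha, hη⟩), comp_inv_cancel a η hae'⟩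

end Etale

/-! ### The ring structure of the Steinberg algebra -/

section SteinbergRing

variable {R G : Type*} [CommRing R] [GroupoidStr G] [TopologicalSpace G] [IsEtaleGroupoid G]

namespace Steinberg

theorem finite_pairs (f g : Steinberg R G) (η : G) :
    {p : Composable G | (f p.1.1 ≠ 0 ∧ g p.1.2 ≠ 0) ∧ compPair p = η}.Finite :=
  have := IsHausdorffGroupoid.t2 (G := G)
  finite_fibre IsHausdorffGroupoid.continuous_comp isLocallyInjective_compPair
    (isCompact_composable f.2.2 g.2.2) η

theorem finite_support (f g : Steinberg R G) (η : G) :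
    ({p : Composable G | compPair p = η} ∩
      Function.support fun p => f p.1.1 * g p.1.2).Finite :=
  (finite_pairs f g η).subset fun _ hp =>
    ⟨⟨left_ne_zero_of_mul hp.2, right_ne_zero_of_mul hp.2⟩, hp.1⟩

theorem conv_mem (f g : Steinberg R G) : conv f g ∈ steinbergModule R G := by
  have := IsHausdorffGroupoid.t2 (G := G)
  set F : Composable G → R := fun p => f p.1.1 * g p.1.2 with hFdef
  have hF : IsLocallyConstant F :=
    (f.2.1.comp_continuous (continuous_fst.comp continuous_subtype_val)).mul
      (g.2.1.comp_continuous (continuous_snd.comp continuous_subtype_val))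
  have hK : IsCompact (Function.support F) :=
    (isCompact_composable f.2.2 g.2.2).of_isClosed_subset (hF.isOpen_fiber 0).isClosed_compl
      fun p hp => ⟨left_ne_zero_of_mul hp, right_ne_zero_of_mul hp⟩
  have hc : IsLocallyConstant (conv f g) := isLocallyConstant_fibreSum
    IsHausdorffGroupoid.continuous_comp isOpenMap_compPair isLocallyInjective_compPair hF hK
  refine ⟨hc, (hK.image IsHausdorffGroupoid.continuous_comp).of_isClosed_subset
    (isClosed_support hc) ?_⟩
  intro η hη
  by_contra hcon
  refine hη (finsum_mem_eq_zero_of_forall_eq_zero fun p hp => ?_)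
  by_contra hne
  exact hcon ⟨p, hne, hp⟩

noncomputable instance : Mul (Steinberg R G) := ⟨fun f g => ⟨conv f g, conv_mem f g⟩⟩

theorem mul_apply (f g : Steinberg R G) (η : G) :
    (f * g) η = ∑ᶠ p ∈ {p : Composable G | compPair p = η}, f p.1.1 * g p.1.2 := rfl

theorem mul_assoc' (f g h : Steinberg R G) : f * g * h = f * (g * h) := by
  have := IsHausdorffGroupoid.t2 (G := G)
  refine Steinberg.ext fun η => ?_
  let T : Type _ := {t : G × G × G // src t.1 = rng t.2.1 ∧ src t.2.1 = rng t.2.2}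
  let pl : T → Composable G := fun t =>
    ⟨(comp t.1.1 t.1.2.1 t.2.1, t.1.2.2), (src_comp _ _ _).trans t.2.2⟩
  let pr : T → Composable G := fun t =>
    ⟨(t.1.1, comp t.1.2.1 t.1.2.2 t.2.2), t.2.1.trans (rng_comp _ _ _).symm⟩
  have hlr : ∀ t, compPair (pl t) = compPair (pr t) := fun t =>
    comp_assoc t.1.1 t.1.2.1 t.1.2.2 t.2.1 t.2.2
  let F : T → R := fun t => f t.1.1 * g t.1.2.1 * h t.1.2.2
  have hfin : {t : T | compPair (pl t) = η ∧ F t ≠ 0}.Finite := by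
    set P : Set G := compPair '' {p : Composable G | p.1.1 ∈ Function.support (f : G → R) ∧
      p.1.2 ∈ Function.support (g : G → R)} with hP
    have hPc : IsCompact P :=
      (isCompact_composable f.2.2 g.2.2).image IsHausdorffGroupoid.continuous_comp
    have hfin1 := finite_fibre (IsHausdorffGroupoid.continuous_comp (G := G))
      isLocallyInjective_compPair (isCompact_composable hPc h.2.2) η
    refine Set.Finite.of_finite_fibers pl (hfin1.subset ?_) ?_
    · rintro _ ⟨t, ⟨h1, h2⟩, rfl⟩
      have h3 := left_ne_zero_of_mul h2
      exact ⟨⟨⟨⟨(t.1.1, t.1.2.1), t.2.1⟩, ⟨left_ne_zero_of_mul h3, right_ne_zero_of_mul h3⟩,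
        rfl⟩, right_ne_zero_of_mul h2⟩, h1⟩
    · intro p _
      refine Set.Finite.of_finite_image (f := fun t : T =>
        (⟨(t.1.1, t.1.2.1), t.2.1⟩ : Composable G)) ((finite_pairs f g p.1.1).subset ?_) ?_
      · rintro _ ⟨t, ⟨⟨-, h2⟩, h4⟩, rfl⟩
        have h3 := left_ne_zero_of_mul h2
        exact ⟨⟨left_ne_zero_of_mul h3, right_ne_zero_of_mul h3⟩, congrArg (fun q => q.1.1) h4⟩
      · rintro t ⟨-, ht⟩ t' ⟨-, ht'⟩ e
        have e1 := congrArg (fun q : Composable G => q.1.1) e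
        have e2 := congrArg (fun q : Composable G => q.1.2) e
        have e3 := congrArg (fun q : Composable G => q.1.2) (ht.trans ht'.symm)
        exact Subtype.ext (Prod.ext e1 (Prod.ext e2 e3))
  have hL : (f * g * h) η = ∑ᶠ t ∈ {t | compPair (pl t) = η}, F t := by
    rw [← finsum_fibre_fibre hfin, mul_apply]
    refine finsum_mem_congr rfl fun p _ => ?_
    rw [mul_apply]
    refine ((AddMonoidHom.mulRight (h p.1.2)).map_finsum_mem' (finite_support f g p.1.1)).trans ?_
    symm
    refine finsum_mem_eq_of_bijOn (fun t : T => (⟨(t.1.1, t.1.2.1), t.2.1⟩ : Composable G))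
      ⟨?_, ?_, ?_⟩ ?_
    · rintro t rfl; rfl
    · rintro t ht t' ht' e
      have e1 := congrArg (fun q : Composable G => q.1.1) e
      have e2 := congrArg (fun q : Composable G => q.1.2) e
      have e3 := congrArg (fun q : Composable G => q.1.2)
        (show pl t = pl t' from Eq.trans ht (Eq.symm ht'))
      exact Subtype.ext (Prod.ext e1 (Prod.ext e2 e3))
    · intro q hq
      have hq' : comp q.1.1 q.1.2 q.2 = p.1.1 := hq
      exact ⟨⟨(q.1.1, q.1.2, p.1.2), q.2,
        by rw [← src_comp q.1.1 q.1.2 q.2, hq']; exact p.2⟩,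
        Subtype.ext (Prod.ext hq' rfl), rfl⟩
    · rintro t rfl; rfl
  have hR : (f * (g * h)) η = ∑ᶠ t ∈ {t | compPair (pr t) = η}, F t := by
    have hfin' : {t : T | compPair (pr t) = η ∧ F t ≠ 0}.Finite := by
      simpa only [hlr] using hfin
    rw [← finsum_fibre_fibre hfin', mul_apply]
    refine finsum_mem_congr rfl fun p _ => ?_
    rw [mul_apply]
    refine ((AddMonoidHom.mulLeft (f p.1.1)).map_finsum_mem' (finite_support g h p.1.2)).trans ?_
    symm
    refine finsum_mem_eq_of_bijOn (fun t : T => (⟨(t.1.2.1, t.1.2.2), t.2.2⟩ : Composable G))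
      ⟨?_, ?_, ?_⟩ ?_
    · rintro t rfl; rfl
    · rintro t ht t' ht' e
      have e1 := congrArg (fun q : Composable G => q.1.1) e
      have e2 := congrArg (fun q : Composable G => q.1.2) e
      have e3 := congrArg (fun q : Composable G => q.1.1)
        (show pr t = pr t' from Eq.trans ht (Eq.symm ht'))
      exact Subtype.ext (Prod.ext e3 (Prod.ext e1 e2))
    · intro q hq
      have hq' : comp q.1.1 q.1.2 q.2 = p.1.2 := hq
      exact ⟨⟨(p.1.1, q.1.1, q.1.2),
        by rw [← rng_comp q.1.1 q.1.2 q.2, hq']; exact p.2, q.2⟩,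
        Subtype.ext (Prod.ext rfl hq'), rfl⟩
    · rintro t rfl; exact mul_assoc _ _ _
  rw [hL, hR]
  simp only [hlr]

noncomputable instance : NonUnitalRing (Steinberg R G) where
  __ := (inferInstance : AddCommGroup (Steinberg R G))
  left_distrib f g h := Steinberg.ext fun η => by
    rw [add_apply, mul_apply, mul_apply, mul_apply,
      ← finsum_mem_add_distrib' (finite_support f g η) (finite_support f h η)]
    exact finsum_mem_congr rfl fun p _ => mul_add _ _ _
  right_distrib f g h := Steinberg.ext fun η => by
    rw [add_apply, mul_apply, mul_apply, mul_apply,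
      ← finsum_mem_add_distrib' (finite_support f h η) (finite_support g h η)]
    exact finsum_mem_congr rfl fun p _ => add_mul _ _ _
  zero_mul f := Steinberg.ext fun η => by
    rw [mul_apply]
    exact finsum_mem_eq_zero_of_forall_eq_zero fun p _ => zero_mul _
  mul_zero f := Steinberg.ext fun η => by
    rw [mul_apply]
    exact finsum_mem_eq_zero_of_forall_eq_zero fun p _ => mul_zero _
  mul_assoc := mul_assoc'

instance : IsScalarTower R (Steinberg R G) (Steinberg R G) where
  smul_assoc r f g := Steinberg.ext fun η => by
    rw [smul_eq_mul, smul_eq_mul, smul_apply, mul_apply, mul_apply]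
    refine Eq.trans ?_ ((AddMonoidHom.mulLeft r).map_finsum_mem' (finite_support f g η)).symm
    exact finsum_mem_congr rfl fun p _ => mul_assoc _ _ _

instance : SMulCommClass R (Steinberg R G) (Steinberg R G) where
  smul_comm r f g := Steinberg.ext fun η => by
    rw [smul_eq_mul, smul_eq_mul, smul_apply, mul_apply, mul_apply]
    refine ((AddMonoidHom.mulLeft r).map_finsum_mem' (finite_support f g η)).trans ?_
    exact finsum_mem_congr rfl fun p _ => mul_left_comm _ _ _

/-! The involution `f*(η) = (f(η⁻¹))*`. -/

variable [StarRing R]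

instance : Star (Steinberg R G) where
  star f := ⟨fun η => star (f (inv η)),
    (f.2.1.comp_continuous IsHausdorffGroupoid.continuous_inv).comp star, by
      have h : Function.support (fun η => star (f (inv η))) =
          inv '' Function.support (f : G → R) := by
        ext η
        simp only [Function.mem_support, ne_eq, star_eq_zero, Set.mem_image]
        exact ⟨fun h => ⟨inv η, h, inv_inv' η⟩, by rintro ⟨x, hx, rfl⟩; rwa [inv_inv']⟩
      rw [h]
      exact f.2.2.image IsHausdorffGroupoid.continuous_inv⟩

theorem star_apply (f : Steinberg R G) (η : G) : star f η = star (f (inv η)) := rfl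

instance : StarRing (Steinberg R G) where
  star_involutive f := Steinberg.ext fun η => by
    rw [star_apply, star_apply, star_star, inv_inv']
  star_add f g := Steinberg.ext fun η => by
    simp only [star_apply, add_apply, star_add]
  star_mul f g := Steinberg.ext fun η => by
    rw [star_apply, mul_apply, mul_apply]
    refine ((starAddEquiv (R := R)).toAddMonoidHom.map_finsum_mem'
      (finite_support f g (inv η))).trans ?_
    refine finsum_mem_eq_of_bijOn (fun p : Composable G => (⟨(inv p.1.2, inv p.1.1),
      (src_inv _).trans (p.2.symm.trans (rng_inv _).symm)⟩ : Composable G)) ⟨?_, ?_, ?_⟩ ?_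
    · intro p hp
      have hp' : comp p.1.1 p.1.2 p.2 = inv η := hp
      show comp _ _ _ = η
      rw [← inv_comp_rev p.1.1 p.1.2 p.2, hp', inv_inv']
    · intro p _ p' _ e
      have e1 : inv p.1.2 = inv p'.1.2 := congrArg (fun q : Composable G => q.1.1) e
      have e2 : inv p.1.1 = inv p'.1.1 := congrArg (fun q : Composable G => q.1.2) e
      exact Subtype.ext (Prod.ext (by rw [← inv_inv' p.1.1, e2, inv_inv'])
        (by rw [← inv_inv' p.1.2, e1, inv_inv']))
    · intro q hq
      have hq' : comp q.1.1 q.1.2 q.2 = η := hq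
      refine ⟨⟨(inv q.1.2, inv q.1.1),
        (src_inv _).trans (q.2.symm.trans (rng_inv _).symm)⟩, ?_, ?_⟩
      · show comp _ _ _ = inv η
        rw [← inv_comp_rev q.1.1 q.1.2 q.2, hq']
      · exact Subtype.ext (Prod.ext (inv_inv' _) (inv_inv' _))
    · intro p _
      show star (f p.1.1 * g p.1.2) = star (g (inv (inv p.1.2))) * star (f (inv (inv p.1.1)))
      rw [inv_inv', inv_inv', star_mul]

instance : StarModule R (Steinberg R G) where
  star_smul r f := Steinberg.ext fun η => by
    rw [star_apply, smul_apply, smul_apply, star_apply, star_mul']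

end Steinberg

end SteinbergRing

/-- The diagonal `D_R(G)`, i.e. the algebra of compactly supported locally constant functions on the
unit space, extended by zero and so regarded as a submodule of `A_R(G)`. As the unit space is clopen
in an étale groupoid, these are the elements of `A_R(G)` that vanish outside the unit space. -/
def diagonal (R G : Type*) [CommRing R] [GroupoidStr G] [TopologicalSpace G] :
    Submodule R (Steinberg R G) where
  carrier := {f | Function.support (f : G → R) ⊆ units G}
  zero_mem' := fun _ h => absurd rfl h
  add_mem' hf hg := fun _ h => (Function.support_add _ _ h).elim (fun h => hf h) (fun h => hg h)
  smul_mem' r _ hf := fun _ h => hf (Function.support_const_smul_subset r _ h)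

/-- The homogeneous component `A_R(G)_g = {f : supp f ⊆ c⁻¹(g)}`. -/
def homogeneous (R : Type*) {G Γ : Type*} [CommRing R] [GroupoidStr G] [TopologicalSpace G]
    [Group Γ] [TopologicalSpace Γ] (c : ContCocycle G Γ) (g : Γ) :
    Submodule R (Steinberg R G) where
  carrier := {f | Function.support (f : G → R) ⊆ c.toFun ⁻¹' {g}}
  zero_mem' := fun _ h => absurd rfl h
  add_mem' hf hg := fun _ h => (Function.support_add _ _ h).elim (fun h => hf h) (fun h => hg h)
  smul_mem' r _ hf := fun _ h => hf (Function.support_const_smul_subset r _ h)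

/-! ## Finitely supported matrices -/

/-- The `R`-module of `ℕ × ℕ`-matrices over `R` with only finitely many non-zero entries. -/
def minftyModule (R : Type*) [CommRing R] : Submodule R (Matrix ℕ ℕ R) where
  carrier := {M | {p : ℕ × ℕ | M p.1 p.2 ≠ 0}.Finite}
  zero_mem' := by simp
  add_mem' {M N} hM hN := (hM.union hN).subset fun p hp => by
    by_contra hcon
    simp only [Set.mem_union, Set.mem_ofPred_eq, not_or, not_not] at hcon
    exact hp (by rw [Matrix.add_apply, hcon.1, hcon.2, add_zero])
  smul_mem' r M hM := hM.subset fun p hp => by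
    intro h
    exact hp (by rw [Matrix.smul_apply, h, smul_zero])

/-- `M_∞(R)`. -/
def Minfty (R : Type*) [CommRing R] : Type _ := minftyModule R

namespace Minfty

variable {R : Type*} [CommRing R]

noncomputable instance : AddCommGroup (Minfty R) := inferInstanceAs (AddCommGroup (minftyModule R))

noncomputable instance : Module R (Minfty R) := inferInstanceAs (Module R (minftyModule R))

instance : CoeFun (Minfty R) (fun _ => ℕ → ℕ → R) := ⟨fun M => M.1⟩

theorem ext {M N : Minfty R} (h : ∀ i j, M i j = N i j) : M = N :=
  Subtype.ext (funext fun i => funext (h i))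

@[simp] theorem add_apply (M N : Minfty R) (i j : ℕ) : (M + N) i j = M i j + N i j := rfl
@[simp] theorem zero_apply (i j : ℕ) : (0 : Minfty R) i j = 0 := rfl
@[simp] theorem smul_apply (r : R) (M : Minfty R) (i j : ℕ) : (r • M) i j = r * M i j := rfl

theorem exists_bound (M : Minfty R) : ∃ n, ∀ i j, n ≤ i ∨ n ≤ j → M i j = 0 := by
  obtain ⟨a, ha⟩ := (M.2.image Prod.fst).bddAbove
  obtain ⟨b, hb⟩ := (M.2.image Prod.snd).bddAbove
  refine ⟨max a b + 1, fun i j hij => ?_⟩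
  by_contra hne
  have h1 : i ≤ a := ha ⟨(i, j), hne, rfl⟩
  have h2 : j ≤ b := hb ⟨(i, j), hne, rfl⟩
  omega

theorem finsum_eq_range {M : Minfty R} {n : ℕ} (hn : ∀ i j, n ≤ i ∨ n ≤ j → M i j = 0)
    (i : ℕ) (v : ℕ → R) : ∑ᶠ k, M i k * v k = ∑ k ∈ Finset.range n, M i k * v k := by
  refine finsum_eq_sum_of_support_subset _ fun k hk => ?_
  by_contra hcon
  refine hk ?_
  show M i k * v k = 0
  rw [hn i k (Or.inr (by simpa using hcon)), zero_mul]

/-- The matrix product `(MN)ᵢⱼ = ∑ₖ Mᵢₖ Nₖⱼ`. -/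
noncomputable instance : Mul (Minfty R) where
  mul M N := ⟨fun i j => ∑ᶠ k, M i k * N k j, by
    obtain ⟨n, hn⟩ := M.exists_bound
    obtain ⟨m, hm⟩ := N.exists_bound
    refine ((Set.finite_Iio n).prod (Set.finite_Iio m)).subset fun p hp => ?_
    by_contra hcon
    refine hp (finsum_eq_zero_of_forall_eq_zero fun k => ?_)
    have h : n ≤ p.1 ∨ m ≤ p.2 := by
      by_contra h
      exact hcon ⟨by simpa using (not_or.mp h).1, by simpa using (not_or.mp h).2⟩
    rcases h with h | h
    · rw [hn _ _ (Or.inl h), zero_mul]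
    · rw [hm _ _ (Or.inr h), mul_zero]⟩

theorem mul_apply (M N : Minfty R) (i j : ℕ) : (M * N) i j = ∑ᶠ k, M i k * N k j := rfl

noncomputable instance : NonUnitalRing (Minfty R) where
  __ := (inferInstance : AddCommGroup (Minfty R))
  left_distrib M N P := Minfty.ext fun i j => by
    obtain ⟨n, hn⟩ := M.exists_bound
    rw [add_apply, mul_apply, mul_apply, mul_apply, finsum_eq_range hn, finsum_eq_range hn,
      finsum_eq_range hn]
    simp only [add_apply, mul_add, Finset.sum_add_distrib]
  right_distrib M N P := Minfty.ext fun i j => by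
    obtain ⟨n, hn⟩ := M.exists_bound
    obtain ⟨m, hm⟩ := N.exists_bound
    obtain ⟨l, hl⟩ := (M + N).exists_bound
    have h1 : ∀ i j, max l (max n m) ≤ i ∨ max l (max n m) ≤ j → M i j = 0 :=
      fun i j h => hn i j (by omega)
    have h2 : ∀ i j, max l (max n m) ≤ i ∨ max l (max n m) ≤ j → N i j = 0 :=
      fun i j h => hm i j (by omega)
    have h3 : ∀ i j, max l (max n m) ≤ i ∨ max l (max n m) ≤ j → (M + N) i j = 0 :=
      fun i j h => hl i j (by omega)
    simp only [mul_apply, add_apply, finsum_eq_range h1, finsum_eq_range h2]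
    refine (finsum_eq_range h3 i fun k => P k j).trans ?_
    simp only [add_apply, add_mul, Finset.sum_add_distrib]
  zero_mul M := Minfty.ext fun i j => by simp [mul_apply]
  mul_zero M := Minfty.ext fun i j => by simp [mul_apply]
  mul_assoc M N P := Minfty.ext fun i j => by
    obtain ⟨n, hn⟩ := M.exists_bound
    obtain ⟨m, hm⟩ := N.exists_bound
    obtain ⟨l, hl⟩ := (M * N).exists_bound
    have h2 : ∀ i j, max l m ≤ i ∨ max l m ≤ j → N i j = 0 :=
      fun i j h => hm i j (by omega)
    have h3 : ∀ i j, max l m ≤ i ∨ max l m ≤ j → (M * N) i j = 0 :=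
      fun i j h => hl i j (by omega)
    rw [mul_apply, finsum_eq_range h3, mul_apply, finsum_eq_range hn]
    simp only [mul_apply, finsum_eq_range hn, finsum_eq_range h2, Finset.sum_mul, Finset.mul_sum]
    rw [Finset.sum_comm]
    simp only [mul_assoc]

instance : IsScalarTower R (Minfty R) (Minfty R) where
  smul_assoc r M N := Minfty.ext fun i j => by
    obtain ⟨n, hn⟩ := M.exists_bound
    have h : ∀ i j, n ≤ i ∨ n ≤ j → (r • M) i j = 0 := fun i j h => by
      rw [smul_apply, hn i j h, mul_zero]
    rw [smul_eq_mul, smul_eq_mul, smul_apply, mul_apply, mul_apply, finsum_eq_range hn,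
      finsum_eq_range h]
    simp only [smul_apply, Finset.mul_sum, mul_assoc]

instance : SMulCommClass R (Minfty R) (Minfty R) where
  smul_comm r M N := Minfty.ext fun i j => by
    obtain ⟨n, hn⟩ := M.exists_bound
    rw [smul_eq_mul, smul_eq_mul, smul_apply, mul_apply, mul_apply, finsum_eq_range hn,
      finsum_eq_range hn]
    simp only [smul_apply, Finset.mul_sum, mul_left_comm]

/-! The involution `(M*)ᵢⱼ = (Mⱼᵢ)*`. -/

variable [StarRing R]

instance : Star (Minfty R) where
  star M := ⟨fun i j => star (M j i), by
    refine (M.2.image Prod.swap).subset fun p hp => ⟨(p.2, p.1), ?_, rfl⟩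
    intro h
    refine hp ?_
    show star (M p.2 p.1) = 0
    rw [show M p.2 p.1 = 0 from h, star_zero]⟩

theorem star_apply (M : Minfty R) (i j : ℕ) : star M i j = star (M j i) := rfl

instance : StarRing (Minfty R) where
  star_involutive M := Minfty.ext fun i j => by rw [star_apply, star_apply, star_star]
  star_add M N := Minfty.ext fun i j => by simp only [star_apply, add_apply, star_add]
  star_mul M N := Minfty.ext fun i j => by
    obtain ⟨n, hn⟩ := M.exists_bound
    obtain ⟨m, hm⟩ := (star N).exists_bound
    have h1 : ∀ i j, max n m ≤ i ∨ max n m ≤ j → M i j = 0 := fun i j h => hn i j (by omega)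
    have h2 : ∀ i j, max n m ≤ i ∨ max n m ≤ j → star N i j = 0 := fun i j h => hm i j (by omega)
    rw [star_apply, mul_apply, mul_apply, finsum_eq_range h1, finsum_eq_range h2, star_sum]
    exact Finset.sum_congr rfl fun k _ => star_mul _ _

instance : StarModule R (Minfty R) where
  star_smul r M := Minfty.ext fun i j => by
    rw [star_apply, smul_apply, smul_apply, star_apply, star_mul']

end Minfty

/-- `D_∞(R)`, the diagonal matrices in `M_∞(R)`. -/
def Dinfty (R : Type*) [CommRing R] : Submodule R (Minfty R) where
  carrier := {M | ∀ i j, i ≠ j → M i j = 0}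
  zero_mem' := fun _ _ _ => rfl
  add_mem' {M N} hM hN := fun i j h => by rw [Minfty.add_apply, hM i j h, hN i j h, add_zero]
  smul_mem' r M hM := fun i j h => by rw [Minfty.smul_apply, hM i j h, mul_zero]

/-! ## Stabilised Steinberg algebras -/

section Stable

variable (R : Type*) [CommRing R]

/-- `A_R(G) ⊗ M_∞(R)`. -/
abbrev StableAlg (G : Type*) [GroupoidStr G] [TopologicalSpace G] : Type _ :=
  Steinberg R G ⊗[R] Minfty R

/-- `D_R(G) ⊗ D_∞(R)`, as a submodule of `A_R(G) ⊗ M_∞(R)`. -/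
noncomputable def stableDiagonal (G : Type*) [GroupoidStr G] [TopologicalSpace G] :
    Submodule R (StableAlg R G) :=
  LinearMap.range (TensorProduct.map (diagonal R G).subtype (Dinfty R).subtype)

/-- `A_R(G)_g ⊗ M_∞(R)`, as a submodule of `A_R(G) ⊗ M_∞(R)`. -/
noncomputable def stableHomogeneous {G Γ : Type*} [GroupoidStr G] [TopologicalSpace G] [Group Γ]
    [TopologicalSpace Γ] (c : ContCocycle G Γ) (g : Γ) : Submodule R (StableAlg R G) :=
  LinearMap.range (TensorProduct.map (homogeneous R c g).subtype
    (LinearMap.id : Minfty R →ₗ[R] Minfty R))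

variable {G₁ G₂ Γ : Type*} [GroupoidStr G₁] [TopologicalSpace G₁] [GroupoidStr G₂]
  [TopologicalSpace G₂] [Group Γ] [TopologicalSpace Γ]

/-- A map between stabilised Steinberg algebras is diagonal-preserving if it maps
`D_R(G₁) ⊗ D_∞(R)` onto `D_R(G₂) ⊗ D_∞(R)`. -/
def DiagonalPreserving (φ : StableAlg R G₁ → StableAlg R G₂) : Prop :=
  φ '' (stableDiagonal R G₁ : Set (StableAlg R G₁)) = stableDiagonal R G₂

/-- A map between stabilised Steinberg algebras is graded if it maps `A_R(G₁)_g ⊗ M_∞(R)` onto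
`A_R(G₂)_g ⊗ M_∞(R)` for all `g ∈ Γ`. -/
def Graded (c₁ : ContCocycle G₁ Γ) (c₂ : ContCocycle G₂ Γ)
    (φ : StableAlg R G₁ → StableAlg R G₂) : Prop :=
  ∀ g : Γ, φ '' (stableHomogeneous R c₁ g : Set (StableAlg R G₁)) = stableHomogeneous R c₂ g

end Stable

end SteinbergStable

/-!
A graded ring isomorphism that preserves the diagonal determines the groupoid because the
normalizers of the diagonal remember the compact open bisections. Call `n` a normalizer if it is
homogeneous and has a homogeneous generalised inverse `m` (so `n m n = n`, `m n m = m`) such that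
conjugation by the pair preserves the diagonal (`IsNormalizerPair`); this notion is stated in
terms of the ring, the diagonal and the grading alone. Characteristic functions of homogeneous
compact open bisections are normalizers (`isNormalizerPair_char`).

The decisive fact is that the support of every normalizer is a bisection
(`IsNormalizerPair.isBisection_support`). Conjugation of projections of the diagonal shows that in
the support of `n` the source determines the range and conversely. Over a unit `x` with a good
isotropy group `K`, the values of `n` and `m` therefore form, after translation by a point of the
support, elements `A` and `B` of `RK` with `B A = 1`; as `RK` has no zero-divisors, `A` is a unit,
hence trivial, so `n` has only one point of its support over `x`. Such `x` are dense, and two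
distinct points of the support over any one source could be moved to such an `x`.

Inclusion of supports of normalizers is then an algebraic relation: `supp n ⊆ supp n'` if and only
if `n = n' d` with `d` in the diagonal (`IsNormalizerPair.support_subset_iff`). So a graded
isomorphism that preserves the diagonal induces an isomorphism of partially ordered sets between
bases of compact open sets of the two groupoids, and hence a homeomorphism
(`exists_homeomorph_of_basis`). It respects the groupoid structure because supports of products
are products of supports, and the cocycles because normalizers are homogeneous
(`exists_groupoidIso_of_ringEquiv`).

For the stabilised algebras, `A_R(G) ⊗ M_∞(R)` is the Steinberg algebra of `G × ℛ`, compatibly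
with the involution, the diagonal and the grading (`stableEquiv`), and the hypothesis on the
isotropy groups passes from `G` to `G × ℛ` (`InClass.stab`). Conversely, composition with an
isomorphism of groupoids is an isomorphism of Steinberg algebras (`GroupoidIso.steinbergEquiv`).
-/

namespace SteinbergStable
open GroupoidStr

/-! ### Bisections of ample groupoids -/

theorem isLocalHomeomorph_of_isOpenMap_of_isLocallyInjective {X Y : Type*} [TopologicalSpace X]
    [TopologicalSpace Y] {f : X → Y} (hc : Continuous f) (ho : IsOpenMap f)
    (hi : IsLocallyInjective f) : IsLocalHomeomorph f := by
  rw [isLocalHomeomorph_iff_isOpenEmbedding_restrict]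
  intro x
  obtain ⟨U, hU, hx, hinj⟩ := hi x
  exact ⟨U, hU.mem_nhds hx, .of_continuous_injective_isOpenMap (hc.comp continuous_subtype_val)
    (Set.injOn_iff_injective.mp hinj) (ho.domRestrict hU)⟩

section Algebraic

variable {H : Type*} [GroupoidStr H]

theorem mem_units_iff_rng {a : H} : a ∈ units H ↔ rng a = a :=
  ⟨by rintro ⟨b, rfl⟩; exact rng_rng b, fun h => ⟨a, h⟩⟩

theorem mem_units_iff_src {a : H} : a ∈ units H ↔ src a = a :=
  ⟨by rintro ⟨b, rfl⟩; exact src_rng b, fun h => ⟨src a, by rw [rng_src, h]⟩⟩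

theorem src_mem_units (a : H) : src a ∈ units H := ⟨src a, rng_src a⟩

theorem rng_mem_units (a : H) : rng a ∈ units H := ⟨a, rfl⟩

theorem inv_injective : Function.Injective (inv : H → H) := fun a b h => by
  rw [← inv_inv' a, h, inv_inv']

/-- A set on which both the source and the range map are injective. -/
structure IsBisection (B : Set H) : Prop where
  src_injOn : Set.InjOn src B
  rng_injOn : Set.InjOn rng B

theorem IsBisection.inv {B : Set H} (h : IsBisection B) : IsBisection (inv '' B) := by
  constructor
  · rintro _ ⟨a, ha, rfl⟩ _ ⟨b, hb, rfl⟩ e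
    rw [src_inv, src_inv] at e
    rw [h.2 ha hb e]
  · rintro _ ⟨a, ha, rfl⟩ _ ⟨b, hb, rfl⟩ e
    rw [rng_inv, rng_inv] at e
    rw [h.1 ha hb e]

end Algebraic

section Ample

variable {H : Type*} [GroupoidStr H] [TopologicalSpace H]

/-- The unit space of an étale groupoid is open: a unit `x` has a neighbourhood on which the range
map is injective, and near `x` that neighbourhood contains both `y` and `rng y`. -/
theorem isOpen_units [IsEtaleGroupoid H] : IsOpen (units H) := by
  rw [isOpen_iff_mem_nhds]
  intro x hx
  obtain ⟨U, hU, hxU, hi⟩ := (IsEtaleGroupoid.rng_localHomeo (G := H)).isLocallyInjective x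
  have h1 : rng ⁻¹' U ∈ 𝓝 x := IsHausdorffGroupoid.continuous_rng.continuousAt
    (hU.mem_nhds (by rwa [mem_units_iff_rng.mp hx]))
  filter_upwards [h1, hU.mem_nhds hxU] with y hy hyU
  exact mem_units_iff_rng.mpr (hi hy hyU (Subtype.ext (rng_rng y)))

theorem isOpenMap_src [IsEtaleGroupoid H] : IsOpenMap (src : H → H) :=
  (isOpen_units.isOpenMap_subtype_val).comp (IsEtaleGroupoid.src_localHomeo (G := H)).isOpenMap

theorem isOpenMap_rng [IsEtaleGroupoid H] : IsOpenMap (rng : H → H) :=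
  (isOpen_units.isOpenMap_subtype_val).comp (IsEtaleGroupoid.rng_localHomeo (G := H)).isOpenMap

theorem isLocallyInjective_src [IsEtaleGroupoid H] : IsLocallyInjective (src : H → H) := fun a =>
  let ⟨U, hU, ha, hi⟩ := (IsEtaleGroupoid.src_localHomeo (G := H)).isLocallyInjective a
  ⟨U, hU, ha, fun _ hx _ hy h => hi hx hy (Subtype.ext h)⟩

theorem isLocallyInjective_rng [IsEtaleGroupoid H] : IsLocallyInjective (rng : H → H) := fun a =>
  let ⟨U, hU, ha, hi⟩ := (IsEtaleGroupoid.rng_localHomeo (G := H)).isLocallyInjective a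
  ⟨U, hU, ha, fun _ hx _ hy h => hi hx hy (Subtype.ext h)⟩

/-- The compact open bisections form a basis of an ample groupoid. -/
theorem exists_compactOpen_bisection [IsAmpleGroupoid H] {O : Set H} (hO : IsOpen O) {a : H}
    (ha : a ∈ O) : ∃ B, IsCompact B ∧ IsOpen B ∧ IsBisection B ∧ a ∈ B ∧ B ⊆ O := by
  obtain ⟨e, hae, he⟩ := IsEtaleGroupoid.src_localHomeo (G := H) a
  obtain ⟨U, hU, haU, hi⟩ := isLocallyInjective_rng a
  -- a neighbourhood of `a` on which the source map is a homeomorphism and the range map injective;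
  -- the bisection is the preimage of a compact open set of units in it
  set N : Set H := e.source ∩ (O ∩ U)
  have hNo : IsOpen N := e.open_source.inter (hO.inter hU)
  have hNs : N ⊆ e.source := Set.inter_subset_left
  obtain ⟨W, ⟨hWc, hWo⟩, haW, hWN⟩ := IsAmpleGroupoid.basis_compactOpen.exists_subset_of_mem_open
    (Set.mem_image_of_mem e (show a ∈ N from ⟨hae, ha, haU⟩))
    (e.isOpen_image_of_subset_source hNo hNs)
  have hWt : W ⊆ e.target :=
    hWN.trans (by rw [← e.image_source_eq_target]; exact Set.image_mono hNs)
  have hsub : e.symm '' W ⊆ N := by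
    rintro _ ⟨w, hw, rfl⟩
    obtain ⟨b, hb, rfl⟩ := hWN hw
    rwa [e.left_inv (hNs hb)]
  refine ⟨e.symm '' W, hWc.image_of_continuousOn (e.continuousOn_symm.mono hWt),
    e.symm.isOpen_image_of_subset_source hWo hWt, ⟨?_, hi.mono (hsub.trans fun x hx => hx.2.2)⟩,
    ⟨e a, haW, e.left_inv hae⟩, hsub.trans fun x hx => hx.2.1⟩
  intro x hx y hy hxy
  refine e.injOn (hNs (hsub hx)) (hNs (hsub hy)) ?_
  rw [← he]
  exact Subtype.ext hxy

end Ample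

/-! ### The product with the full equivalence relation -/

section Product

section Units

variable {G : Type*} [GroupoidStr G]

theorem mem_units_prod {a : G × FullRel} : a ∈ units (G × FullRel) ↔ a.1 ∈ units G ∧
    a.2.1 = a.2.2 := by
  rw [mem_units_iff_rng, mem_units_iff_rng]
  constructor
  · intro h
    exact ⟨congrArg Prod.fst h, congrArg (fun p : G × FullRel => p.2.2) h⟩
  · rintro ⟨h, h'⟩
    exact Prod.ext h (Prod.ext rfl h')

/-- The inclusion of `G⁰` into the unit space of `G × ℛ` at the `i`-th diagonal position. -/
def unitAt (i : ℕ) (x : units G) : units (G × FullRel) :=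
  ⟨(x.1, (i, i)), mem_units_prod.mpr ⟨x.2, rfl⟩⟩

theorem exists_eq_unitAt (x : units (G × FullRel)) : ∃ i y, x = unitAt i y := by
  obtain ⟨⟨a, i, j⟩, hx⟩ := x
  obtain ⟨h1, h2⟩ := mem_units_prod.mp hx
  obtain rfl : i = j := h2
  exact ⟨i, ⟨a, h1⟩, rfl⟩

end Units

variable {G : Type*} [GroupoidStr G] [TopologicalSpace G]

/-- A map that factors through the unit space is a local homeomorphism onto the unit space as soon
as it is continuous, open and locally injective as a map to the groupoid. -/
theorem isLocalHomeomorph_toUnits {H : Type*} [GroupoidStr H] [TopologicalSpace H]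
    {f : H → units H} (hc : Continuous fun a => (f a : H)) (ho : IsOpenMap fun a => (f a : H))
    (hi : IsLocallyInjective fun a => (f a : H)) : IsLocalHomeomorph f := by
  refine isLocalHomeomorph_of_isOpenMap_of_isLocallyInjective
    (continuous_induced_rng.mpr hc) (fun O hO => ?_) fun a => ?_
  · refine ⟨_, ho O hO, ?_⟩
    ext x
    constructor
    · rintro ⟨a, ha, h⟩
      exact ⟨a, ha, Subtype.ext h⟩
    · rintro ⟨a, ha, rfl⟩
      exact ⟨a, ha, rfl⟩
  · obtain ⟨U, hU, ha, h⟩ := hi a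
    exact ⟨U, hU, ha, fun x hx y hy e => h hx hy (congrArg Subtype.val e)⟩

theorem isLocallyInjective_prodMap_discrete {X Y Z W : Type*} [TopologicalSpace X]
    [TopologicalSpace Y] [DiscreteTopology Y] {f : X → Z} (g : Y → W)
    (hf : IsLocallyInjective f) : IsLocallyInjective (Prod.map f g) := by
  rintro ⟨x, y⟩
  obtain ⟨U, hU, hx, hi⟩ := hf x
  refine ⟨U ×ˢ {y}, hU.prod (isOpen_discrete _), ⟨hx, rfl⟩, ?_⟩
  rintro ⟨a, b⟩ ⟨ha, rfl⟩ ⟨a', b'⟩ ⟨ha', rfl⟩ e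
  exact Prod.ext (hi ha ha' (congrArg Prod.fst e)) rfl

instance [IsHausdorffGroupoid G] : IsHausdorffGroupoid (G × FullRel) where
  t2 := have := IsHausdorffGroupoid.t2 (G := G); inferInstance
  continuous_src := IsHausdorffGroupoid.continuous_src.prodMap continuous_of_discreteTopology
  continuous_rng := IsHausdorffGroupoid.continuous_rng.prodMap continuous_of_discreteTopology
  continuous_inv := IsHausdorffGroupoid.continuous_inv.prodMap continuous_of_discreteTopology
  continuous_comp := by
    refine Continuous.prodMk (f := fun p : Composable (G × FullRel) => (compPair p).1) ?_ ?_
    · exact (IsHausdorffGroupoid.continuous_comp (G := G)).comp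
        (f := fun p : Composable (G × FullRel) =>
          (⟨(p.1.1.1, p.1.2.1), congrArg Prod.fst p.2⟩ : Composable G))
        (Continuous.subtype_mk (by fun_prop) _)
    · let f : FullRel × FullRel → FullRel := fun q => (q.1.1, q.2.2)
      exact (continuous_of_discreteTopology (f := f)).comp
        (f := fun p : Composable (G × FullRel) => (p.1.1.2, p.1.2.2)) (by fun_prop)

instance [IsEtaleGroupoid G] : IsEtaleGroupoid (G × FullRel) where
  src_localHomeo := isLocalHomeomorph_toUnits IsHausdorffGroupoid.continuous_src
    (isOpenMap_src.prodMap fun _ _ => isOpen_discrete _)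
    (isLocallyInjective_prodMap_discrete _ isLocallyInjective_src)
  rng_localHomeo := isLocalHomeomorph_toUnits IsHausdorffGroupoid.continuous_rng
    (isOpenMap_rng.prodMap fun _ _ => isOpen_discrete _)
    (isLocallyInjective_prodMap_discrete _ isLocallyInjective_rng)

theorem continuous_unitAt (i : ℕ) : Continuous (unitAt (G := G) i) :=
  Continuous.subtype_mk (continuous_subtype_val.prodMk continuous_const) _

theorem isOpenMap_unitAt (i : ℕ) : IsOpenMap (unitAt (G := G) i) := by
  intro W hW
  obtain ⟨O, hO, rfl⟩ := isOpen_induced_iff.mp hW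
  refine ⟨O ×ˢ {((i, i) : FullRel)}, hO.prod (isOpen_discrete _), ?_⟩
  ext x
  obtain ⟨j, y, rfl⟩ := exists_eq_unitAt x
  constructor
  · rintro ⟨h1, h2⟩
    obtain rfl : j = i := congrArg (fun q : FullRel => q.1) h2
    exact ⟨y, h1, rfl⟩
  · rintro ⟨z, hz, e⟩
    rw [← e]
    exact ⟨hz, rfl⟩

instance [IsAmpleGroupoid G] : IsAmpleGroupoid (G × FullRel) where
  basis_compactOpen := by
    refine TopologicalSpace.isTopologicalBasis_of_isOpen_of_nhds (fun U hU => hU.2) ?_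
    intro x O hx hO
    obtain ⟨i, y, rfl⟩ := exists_eq_unitAt x
    obtain ⟨W, ⟨hWc, hWo⟩, hy, hW⟩ :=
      IsAmpleGroupoid.basis_compactOpen.exists_subset_of_mem_open (a := y)
        (u := unitAt i ⁻¹' O) hx (hO.preimage (continuous_unitAt i))
    exact ⟨unitAt i '' W, ⟨hWc.image (continuous_unitAt i), isOpenMap_unitAt i W hWo⟩,
      ⟨y, hy, rfl⟩, Set.image_subset_iff.mpr hW⟩

/-- The isotropy of the stabilised cocycle at a unit of `G × ℛ` is that of the original cocycle. -/
def isotropyStabEquiv {Γ : Type*} [Group Γ] [TopologicalSpace Γ] (c : ContCocycle G Γ) (i : ℕ)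
    (x : units G) : c.IsotropyKernel x ≃* c.stab.IsotropyKernel (unitAt i x) where
  toFun a := ⟨(a.1, (i, i)), Prod.ext a.2.1 rfl, Prod.ext a.2.2.1 rfl, a.2.2.2⟩
  invFun a := ⟨a.1.1, congrArg Prod.fst a.2.1, congrArg Prod.fst a.2.2.1, a.2.2.2⟩
  left_inv _ := rfl
  right_inv a := by
    refine Subtype.ext (Prod.ext rfl (Prod.ext ?_ ?_))
    · exact (congrArg (fun p : G × FullRel => p.2.1) a.2.2.1).symm
    · exact (congrArg (fun p : G × FullRel => p.2.1) a.2.1).symm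
  map_mul' _ _ := rfl

theorem GoodGroupRing.congr {R H K : Type*} [CommRing R] [Group H] [Group K]
    (h : GoodGroupRing R H) (e : H ≃* K) : GoodGroupRing R K := by
  let E : MonoidAlgebra R H ≃ₐ[R] MonoidAlgebra R K := MonoidAlgebra.domCongr R R e
  have := h.1
  refine ⟨E.symm.injective.noZeroDivisors _ (map_zero _) (map_mul _), fun a ha => ?_⟩
  obtain ⟨u, k, hk⟩ := h.2 (E.symm a) (ha.map E.symm)
  refine ⟨u, e k, ?_⟩
  rw [← E.apply_symm_apply a, hk]
  simp [E]

theorem InClass.stab {R Γ : Type*} [CommRing R] [Group Γ] [TopologicalSpace Γ]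
    {c : ContCocycle G Γ} (h : InClass R c) : InClass R c.stab := by
  obtain ⟨X, hX, hg⟩ := h
  refine ⟨⋃ i, unitAt i '' X, ?_, ?_⟩
  · intro x
    obtain ⟨i, y, rfl⟩ := exists_eq_unitAt x
    exact closure_mono (Set.subset_iUnion (fun i => unitAt i '' X) i)
      (image_closure_subset_closure_image (continuous_unitAt i) ⟨y, hX y, rfl⟩)
  · intro x hx
    obtain ⟨i, y, hy, rfl⟩ := Set.mem_iUnion.mp hx
    exact (hg y hy).congr (isotropyStabEquiv c i y)

end Product

/-! ### Convolution with elements of the diagonal -/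

section Convolution

variable {R H : Type*} [CommRing R] [GroupoidStr H] [TopologicalSpace H]

theorem apply_eq_zero_of_mem_diagonal {d : Steinberg R H} (hd : d ∈ diagonal R H) {a : H}
    (ha : a ∉ units H) : d a = 0 :=
  by_contra fun h => ha (hd h)

theorem Steinberg.isOpen_support {R X : Type*} [CommRing R] [TopologicalSpace X]
    (f : Steinberg R X) : IsOpen (Function.support (f : X → R)) :=
  (f.2.1.isClosed_fiber 0).isOpen_compl

variable [IsEtaleGroupoid H]

namespace Steinberg

theorem exists_of_mul_apply_ne_zero {f g : Steinberg R H} {η : H} (h : (f * g) η ≠ 0) :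
    ∃ (a b : H) (hab : src a = rng b), comp a b hab = η ∧ f a ≠ 0 ∧ g b ≠ 0 := by
  by_contra! hcon
  refine h (finsum_mem_eq_zero_of_forall_eq_zero fun p hp => ?_)
  by_contra hne
  exact hne (by rw [hcon p.1.1 p.1.2 p.2 hp (left_ne_zero_of_mul hne), mul_zero])

/-- If `ab` has no factorisation other than `(a, b)` that contributes to the convolution, then the
convolution at `ab` has a single term. -/
theorem mul_apply_comp {f g : Steinberg R H} {a b : H} (hab : src a = rng b)
    (hu : ∀ a' b' (h : src a' = rng b'), comp a' b' h = comp a b hab → f a' ≠ 0 → g b' ≠ 0 →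
      a' = a) : (f * g) (comp a b hab) = f a * g b := by
  rw [mul_apply]
  have h : ∑ᶠ p ∈ {p : Composable H | compPair p = comp a b hab}, f p.1.1 * g p.1.2 =
      ∑ᶠ p ∈ ({⟨(a, b), hab⟩} : Set (Composable H)), f p.1.1 * g p.1.2 := by
    refine finsum_mem_inter_support_eq' _ _ _ fun p hp => ⟨fun h => ?_, ?_⟩
    · obtain ⟨⟨a', b'⟩, h'⟩ := p
      obtain rfl := hu a' b' h' h (left_ne_zero_of_mul hp) (right_ne_zero_of_mul hp)
      obtain rfl := comp_left_cancel h' hab h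
      rfl
    · rintro rfl
      rfl
  rw [h, finsum_mem_singleton]

theorem mul_diag_apply {f d : Steinberg R H} (hd : d ∈ diagonal R H) (η : H) :
    (f * d) η = f η * d (src η) := by
  have h := mul_apply_comp (f := f) (g := d) (rng_src η).symm (fun a b hab e _ hb => by
    rw [comp_src] at e
    have hb' : b = src a := by rw [hab, mem_units_iff_rng.mp (hd hb)]
    rw [← e, comp_congr rfl hb', comp_src])
  rwa [comp_src] at h

theorem diag_mul_apply {f d : Steinberg R H} (hd : d ∈ diagonal R H) (η : H) :
    (d * f) η = d (rng η) * f η := by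
  have h := mul_apply_comp (f := d) (g := f) (src_rng η) (fun a b hab e ha _ => by
    have ha' : a = rng a := (mem_units_iff_rng.mp (hd ha)).symm
    rw [ha', ← rng_comp a b hab, e, rng_comp, rng_rng])
  rwa [rng_comp_self] at h

theorem diag_mul_comm {d e : Steinberg R H} (hd : d ∈ diagonal R H) (he : e ∈ diagonal R H) :
    d * e = e * d := Steinberg.ext fun η => by
  rw [mul_diag_apply he, diag_mul_apply he]
  by_cases h : η ∈ units H
  · rw [mem_units_iff_src.mp h, mem_units_iff_rng.mp h, mul_comm]
  · rw [apply_eq_zero_of_mem_diagonal hd h, zero_mul, mul_zero]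

theorem mul_mem_homogeneous {Γ : Type*} [Group Γ] [TopologicalSpace Γ] {c : ContCocycle H Γ}
    {g g' : Γ} {f f' : Steinberg R H} (hf : f ∈ homogeneous R c g)
    (hf' : f' ∈ homogeneous R c g') : f * f' ∈ homogeneous R c (g * g') := fun η h => by
  obtain ⟨a, b, hab, rfl, ha, hb⟩ := exists_of_mul_apply_ne_zero h
  show c.toFun _ = _
  rw [c.map_comp, show c.toFun a = g from hf ha, show c.toFun b = g' from hf' hb]

variable (R) in
/-- The characteristic function of a compact open set. -/
noncomputable def char (B : Set H) (hB : IsCompact B) (hB' : IsOpen B) : Steinberg R H :=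
  ⟨B.indicator 1, by
    have := IsHausdorffGroupoid.t2 (G := H)
    have h : IsLocallyConstant (B.indicator (1 : H → R)) := by
      rw [IsLocallyConstant.iff_eventually_eq]
      intro a
      by_cases ha : a ∈ B
      · filter_upwards [hB'.mem_nhds ha] with b hb
        simp [ha, hb]
      · filter_upwards [hB.isClosed.isOpen_compl.mem_nhds ha] with b hb
        rw [Set.indicator_of_notMem ha, Set.indicator_of_notMem hb]
    exact ⟨h, hB.of_isClosed_subset (isClosed_support h) Set.support_indicator_subset⟩⟩

theorem char_of_mem {B : Set H} (hB : IsCompact B) (hB' : IsOpen B) {a : H} (ha : a ∈ B) :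
    char R B hB hB' a = 1 := Set.indicator_of_mem ha _

theorem char_of_notMem {B : Set H} (hB : IsCompact B) (hB' : IsOpen B) {a : H} (ha : a ∉ B) :
    char R B hB hB' a = 0 := Set.indicator_of_notMem ha _

theorem mem_of_char_ne_zero {B : Set H} {hB : IsCompact B} {hB' : IsOpen B} {a : H}
    (h : char R B hB hB' a ≠ 0) : a ∈ B :=
  by_contra fun ha => h (char_of_notMem hB hB' ha)

theorem support_char_subset {B : Set H} (hB : IsCompact B) (hB' : IsOpen B) :
    Function.support (char R B hB hB' : H → R) ⊆ B := fun _ h => mem_of_char_ne_zero h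

theorem char_mem_diagonal {B : Set H} {hB : IsCompact B} {hB' : IsOpen B} (h : B ⊆ units H) :
    char R B hB hB' ∈ diagonal R H := fun _ ha => h (mem_of_char_ne_zero ha)

/-- The diagonal contains local units. -/
theorem exists_diag_mul_eq_self (f : Steinberg R H) : ∃ e ∈ diagonal R H, f * e = f := by
  have hc := f.2.2.image (IsHausdorffGroupoid.continuous_src (G := H))
  have ho := isOpenMap_src _ (isOpen_support f)
  have hd : char R _ hc ho ∈ diagonal R H :=
    char_mem_diagonal (by rintro _ ⟨a, -, rfl⟩; exact src_mem_units a)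
  refine ⟨_, hd, Steinberg.ext fun η => ?_⟩
  rw [mul_diag_apply hd]
  by_cases h : f η = 0
  · rw [h, zero_mul]
  · rw [char_of_mem hc ho ⟨η, h, rfl⟩, mul_one]

end Steinberg

end Convolution

/-! ### Normalizers of the diagonal -/

section Normalizer

variable {R H : Type*} [CommRing R] [GroupoidStr H] [TopologicalSpace H] [IsAmpleGroupoid H]
  {Γ : Type*} [Group Γ] [TopologicalSpace Γ]

open Steinberg

/-- A homogeneous element `n` and a generalised inverse `m` of it, such that conjugation by them
preserves the diagonal. The standard examples are the characteristic functions of a homogeneous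
compact open bisection and of its inverse. -/
structure IsNormalizerPair (c : ContCocycle H Γ) (n m : Steinberg R H) : Prop where
  homogeneous : ∃ g, n ∈ homogeneous R c g ∧ m ∈ homogeneous R c g⁻¹
  mul_mul_left : n * m * n = n
  mul_mul_right : m * n * m = m
  conj_left : ∀ d ∈ diagonal R H, n * d * m ∈ diagonal R H
  conj_right : ∀ d ∈ diagonal R H, m * d * n ∈ diagonal R H

namespace IsNormalizerPair

variable {c : ContCocycle H Γ} {n m n' m' : Steinberg R H}

theorem symm (h : IsNormalizerPair c n m) : IsNormalizerPair c m n where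
  homogeneous := let ⟨g, hn, hm⟩ := h.homogeneous; ⟨g⁻¹, hm, by rwa [inv_inv]⟩
  mul_mul_left := h.mul_mul_right
  mul_mul_right := h.mul_mul_left
  conj_left := h.conj_right
  conj_right := h.conj_left

theorem mul_mem_diagonal (h : IsNormalizerPair c n m) : n * m ∈ diagonal R H := by
  obtain ⟨e, he, hne⟩ := exists_diag_mul_eq_self n
  have := h.conj_left e he
  rwa [hne] at this

theorem mul (h : IsNormalizerPair c n m) (h' : IsNormalizerPair c n' m') :
    IsNormalizerPair c (n * n') (m' * m) where
  homogeneous := by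
    obtain ⟨g, hn, hm⟩ := h.homogeneous
    obtain ⟨g', hn', hm'⟩ := h'.homogeneous
    exact ⟨g * g', mul_mem_homogeneous hn hn', by
      rw [mul_inv_rev]; exact mul_mem_homogeneous hm' hm⟩
  mul_mul_left := by
    have hc := diag_mul_comm h.symm.mul_mem_diagonal h'.mul_mem_diagonal
    calc n * n' * (m' * m) * (n * n') = n * ((n' * m') * (m * n)) * n' := by simp only [mul_assoc]
      _ = (n * m * n) * (n' * m' * n') := by rw [← hc]; simp only [mul_assoc]
      _ = n * n' := by rw [h.mul_mul_left, h'.mul_mul_left]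
  mul_mul_right := by
    have hc := diag_mul_comm h.symm.mul_mem_diagonal h'.mul_mem_diagonal
    calc m' * m * (n * n') * (m' * m) = m' * ((m * n) * (n' * m')) * m := by simp only [mul_assoc]
      _ = (m' * n' * m') * (m * n * m) := by rw [hc]; simp only [mul_assoc]
      _ = m' * m := by rw [h.mul_mul_right, h'.mul_mul_right]
  conj_left d hd := by
    have := h.conj_left _ (h'.conj_left d hd)
    simpa only [mul_assoc] using this
  conj_right d hd := by
    have := h'.conj_right _ (h.conj_right d hd)
    simpa only [mul_assoc] using this

section Domain

variable [IsDomain R]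

/-- The idempotent `m * n` of the diagonal takes the value `1` at the sources of the support of
`n`. -/
theorem mul_apply_src (h : IsNormalizerPair c n m) {a : H} (ha : n a ≠ 0) :
    (m * n) (src a) = 1 := by
  have h1 := mul_diag_apply (f := n) h.symm.mul_mem_diagonal a
  rw [← mul_assoc, h.mul_mul_left] at h1
  exact (mul_eq_left₀ ha).mp h1.symm

theorem mul_apply_rng (h : IsNormalizerPair c n m) {a : H} (ha : n a ≠ 0) :
    (n * m) (rng a) = 1 := by
  have h1 := diag_mul_apply (f := n) h.mul_mem_diagonal a
  rw [h.mul_mul_left] at h1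
  exact (mul_eq_right₀ ha).mp h1.symm

/-- The source of an element of the support of `n` determines its range: otherwise there is a
projection `w` in the diagonal that separates the ranges, and as `n (m w n) = w n`, the element
`m w n` of the diagonal would have to take two values at the source. -/
theorem rng_eq_of_src_eq (h : IsNormalizerPair c n m) {a b : H} (ha : n a ≠ 0)
    (hb : n b ≠ 0) (hab : src a = src b) : rng a = rng b := by
  have := IsHausdorffGroupoid.t2 (G := H)
  by_contra hne
  obtain ⟨W, hW, hW', -, haW, hWO⟩ := exists_compactOpen_bisection (a := rng a)
    (isOpen_units.inter (isOpen_compl_singleton (x := rng b))) ⟨rng_mem_units a, hne⟩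
  have hw : char R W hW hW' ∈ diagonal R H := char_mem_diagonal fun x hx => (hWO hx).1
  set w := char R W hW hW' with hwdef
  have hd := h.conj_right w hw
  have e : n * (m * w * n) = w * n := by
    calc n * (m * w * n) = (n * m) * w * n := by simp only [mul_assoc]
      _ = w * (n * m * n) := by
        rw [diag_mul_comm h.mul_mem_diagonal hw]; simp only [mul_assoc]
      _ = w * n := by rw [h.mul_mul_left]
  have e1 := congrArg (fun f : Steinberg R H => f a) e
  have e2 := congrArg (fun f : Steinberg R H => f b) e
  simp only [mul_diag_apply hd, diag_mul_apply hw] at e1 e2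
  rw [char_of_mem hW hW' haW, one_mul] at e1
  rw [char_of_notMem hW hW' fun hx => (hWO hx).2 rfl, zero_mul, ← hab] at e2
  rw [(mul_eq_zero.mp e2).resolve_left hb, mul_zero] at e1
  exact ha e1.symm

/-- The range of an element of the support of `n` determines its source. -/
theorem src_eq_of_rng_eq (h : IsNormalizerPair c n m) {a b : H} (ha : n a ≠ 0)
    (hb : n b ≠ 0) (hab : rng a = rng b) : src a = src b := by
  have := IsHausdorffGroupoid.t2 (G := H)
  by_contra hne
  obtain ⟨W, hW, hW', -, haW, hWO⟩ := exists_compactOpen_bisection (a := src a)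
    (isOpen_units.inter (isOpen_compl_singleton (x := src b))) ⟨src_mem_units a, hne⟩
  have hw : char R W hW hW' ∈ diagonal R H := char_mem_diagonal fun x hx => (hWO hx).1
  set w := char R W hW hW' with hwdef
  have hd := h.conj_left w hw
  have e : (n * w * m) * n = n * w := by
    calc (n * w * m) * n = n * (w * (m * n)) := by simp only [mul_assoc]
      _ = (n * m * n) * w := by
        rw [← diag_mul_comm h.symm.mul_mem_diagonal hw]; simp only [mul_assoc]
      _ = n * w := by rw [h.mul_mul_left]
  have e1 := congrArg (fun f : Steinberg R H => f a) e
  have e2 := congrArg (fun f : Steinberg R H => f b) e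
  simp only [mul_diag_apply hw, diag_mul_apply hd] at e1 e2
  rw [char_of_mem hW hW' haW, mul_one] at e1
  rw [char_of_notMem hW hW' fun hx => (hWO hx).2 rfl, mul_zero, ← hab] at e2
  rw [(mul_eq_zero.mp e2).resolve_right hb, zero_mul] at e1
  exact ha e1.symm

/-- Over every source that meets the support of `n` there is a point at which `n` does not vanish
and at whose inverse `m` does not vanish. -/
theorem exists_inv_ne_zero (h : IsNormalizerPair c n m) {a : H} (ha : n a ≠ 0) :
    ∃ b, n b ≠ 0 ∧ m (inv b) ≠ 0 ∧ src b = src a := by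
  have h1 : (m * n) (src a) ≠ 0 := by rw [h.mul_apply_src ha]; exact one_ne_zero
  obtain ⟨y, b, hyb, e, hy, hb⟩ := exists_of_mul_apply_ne_zero h1
  have hsb : src b = src a := by rw [← src_comp y b hyb, e, src_src]
  have hry : rng y = src a := by rw [← rng_comp y b hyb, e, rng_src]
  have hb' : b = inv y := eq_inv_of_comp hyb (by rw [e, hry])
  exact ⟨b, hb, by rwa [hb', inv_inv'], hsb⟩

end Domain

end IsNormalizerPair

end Normalizer

/-! ### The support of a normalizer is a bisection -/

section Support

variable {R H : Type*} [CommRing R] [GroupoidStr H] [TopologicalSpace H]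
  [IsAmpleGroupoid H] {Γ : Type*} [Group Γ] [TopologicalSpace Γ]

open Steinberg

/-- The set of elements of an étale groupoid with given source at which `f` does not vanish is
finite. -/
theorem Steinberg.finite_support_src (f : Steinberg R H) (x : H) :
    {b | f b ≠ 0 ∧ src b = x}.Finite :=
  have := IsHausdorffGroupoid.t2 (G := H)
  finite_fibre IsHausdorffGroupoid.continuous_src isLocallyInjective_src f.2.2 x

theorem Steinberg.finite_support_rng (f : Steinberg R H) (x : H) :
    {b | f b ≠ 0 ∧ rng b = x}.Finite :=
  have := IsHausdorffGroupoid.t2 (G := H)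
  finite_fibre IsHausdorffGroupoid.continuous_rng isLocallyInjective_rng f.2.2 x

theorem Steinberg.mul_mem_diagonal_of_bisection {B : Set H} (hbis : IsBisection B)
    {f f' : Steinberg R H} (hf : Function.support (f : H → R) ⊆ B)
    (hf' : Function.support (f' : H → R) ⊆ inv '' B) : f * f' ∈ diagonal R H := fun y hy => by
  obtain ⟨α, β, hαβ, rfl, hα, hβ⟩ := exists_of_mul_apply_ne_zero hy
  obtain ⟨b, hb, rfl⟩ := hf' hβ
  have e := hbis.1 (hf hα) hb (hαβ.trans (rng_inv b))
  rw [comp_congr e rfl, comp_inv]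
  exact rng_mem_units b

theorem Steinberg.char_mul_char_mul_char {B C : Set H} (hbis : IsBisection B) (hB : IsCompact B)
    (hB' : IsOpen B) (hC : IsCompact C) (hC' : IsOpen C) (hBC : inv '' B = C) :
    char R B hB hB' * char R C hC hC' * char R B hB hB' = char R B hB hB' := by
  refine Steinberg.ext fun a => ?_
  rw [diag_mul_apply (mul_mem_diagonal_of_bisection hbis (fun _ h => mem_of_char_ne_zero h)
    fun _ h => hBC.symm ▸ mem_of_char_ne_zero h)]
  by_cases ha : a ∈ B
  · rw [← comp_inv a, mul_apply_comp (rng_inv a).symm fun a' b' h' e ha' _ =>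
      hbis.2 (mem_of_char_ne_zero ha') ha (by rw [← rng_comp a' b' h', e, rng_comp]),
      char_of_mem hB hB' ha, char_of_mem hC hC' (hBC ▸ Set.mem_image_of_mem _ ha), mul_one, mul_one]
  · rw [char_of_notMem hB hB' ha, mul_zero]

/-- The characteristic function of a homogeneous compact open bisection `B` is a normalizer, with
generalised inverse the characteristic function of the inverse `C` of `B`. -/
theorem isNormalizerPair_char (c : ContCocycle H Γ) {B C : Set H} (hB : IsCompact B)
    (hB' : IsOpen B) (hbis : IsBisection B) {g : Γ} (hg : ∀ a ∈ B, c.toFun a = g)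
    (hC : IsCompact C) (hC' : IsOpen C) (hBC : inv '' B = C) :
    IsNormalizerPair c (char R B hB hB') (char R C hC hC') := by
  have hCB : inv '' C = B := by
    rw [← hBC, Set.image_image]
    simp only [inv_inv', Set.image_id']
  refine ⟨⟨g, fun a ha => hg a (mem_of_char_ne_zero ha), fun a ha => ?_⟩,
    char_mul_char_mul_char hbis _ _ _ _ hBC, char_mul_char_mul_char (hBC ▸ hbis.inv) _ _ _ _ hCB,
    fun d hd => ?_, fun d hd => ?_⟩
  · obtain ⟨b, hb, rfl⟩ := hBC.symm ▸ mem_of_char_ne_zero ha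
    show c.toFun (inv b) = g⁻¹
    rw [c.map_inv, hg b hb]
  · refine mul_mem_diagonal_of_bisection hbis (fun a ha => ?_) fun a ha =>
      hBC.symm ▸ mem_of_char_ne_zero ha
    rw [Function.mem_support, mul_diag_apply hd] at ha
    exact mem_of_char_ne_zero (left_ne_zero_of_mul ha)
  · refine mul_mem_diagonal_of_bisection (hBC ▸ hbis.inv) (fun a ha => ?_) fun a ha =>
      hCB.symm ▸ mem_of_char_ne_zero ha
    rw [Function.mem_support, mul_diag_apply hd] at ha
    exact mem_of_char_ne_zero (left_ne_zero_of_mul ha)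

/-- The homogeneous compact open bisections are supports of normalizers, and they form a basis. -/
theorem exists_isNormalizerPair_char [DiscreteTopology Γ] (c : ContCocycle H Γ) {O : Set H}
    (hO : IsOpen O) {a : H} (ha : a ∈ O) : ∃ (B : Set H) (hB : IsCompact B) (hB' : IsOpen B)
      (m : Steinberg R H), IsNormalizerPair c (char R B hB hB') m ∧ a ∈ B ∧ B ⊆ O := by
  obtain ⟨B, hB, hB', hbis, haB, hBO⟩ := exists_compactOpen_bisection
    (hO.inter ((isOpen_discrete {c.toFun a}).preimage c.continuous_toFun)) ⟨ha, rfl⟩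
  have hopen : IsOpen (inv '' B) := by
    rw [Set.image_eq_preimage_of_inverse inv_inv' inv_inv']
    exact hB'.preimage IsHausdorffGroupoid.continuous_inv
  exact ⟨B, hB, hB', _, isNormalizerPair_char c hB hB' hbis (fun b hb => (hBO hb).2)
    (hB.image IsHausdorffGroupoid.continuous_inv) hopen rfl, haB, fun b hb => (hBO hb).1⟩

variable [IsDomain R]

namespace IsNormalizerPair

variable {c : ContCocycle H Γ} {n m : Steinberg R H}

/-- Fix `a` with source `x` in the support of `n`. The elements `∑ n(ak) k` and `∑ m(ka⁻¹) k` of the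
group ring of the isotropy group at `x` have product `1`. If all units of that group ring are
trivial, `a` is therefore the only point of the support of `n` with source `x`. -/
theorem eq_of_src_eq_of_good (h : IsNormalizerPair c n m) {x : units H}
    (hx : GoodGroupRing R (c.IsotropyKernel x)) {a b : H} (ha : n a ≠ 0) (hb : n b ≠ 0)
    (hax : src a = x) (hbx : src b = x) : a = b := by
  obtain ⟨g, hn, hm⟩ := h.homogeneous
  have hca : c.toFun a = g := hn ha
  have hcb : c.toFun b = g := hn hb
  -- translation of the isotropy group by `a` on the left, and by its inverse on the right
  let p : c.IsotropyKernel x → H := fun k => comp a k.1 (hax.trans k.2.2.1.symm)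
  let q : c.IsotropyKernel x → H := fun k =>
    comp k.1 (inv a) (k.2.1.trans (hax.symm.trans (rng_inv a).symm))
  have hp : Function.Injective p := fun k l e => Subtype.ext (comp_left_cancel _ _ e)
  have hq : Function.Injective q := fun k l e => by
    have e' := congrArg inv e
    simp only [q, inv_comp_rev] at e'
    exact Subtype.ext (inv_injective (comp_left_cancel _ _ e'))
  have hAf : (Function.support fun k => n (p k)).Finite :=
    Set.Finite.of_finite_image ((n.finite_support_src x).subset (by
      rintro _ ⟨k, hk, rfl⟩
      exact ⟨hk, (src_comp _ _ _).trans k.2.1⟩)) hp.injOn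
  have hBf : (Function.support fun k => m (q k)).Finite :=
    Set.Finite.of_finite_image ((m.finite_support_rng x).subset (by
      rintro _ ⟨k, hk, rfl⟩
      exact ⟨hk, (rng_comp _ _ _).trans k.2.2.1⟩)) hq.injOn
  let A : MonoidAlgebra R (c.IsotropyKernel x) := .ofCoeff (Finsupp.ofSupportFinite _ hAf)
  let B : MonoidAlgebra R (c.IsotropyKernel x) := .ofCoeff (Finsupp.ofSupportFinite _ hBf)
  have hA : ∀ k, A.coeff k = n (p k) := fun _ => rfl
  have hB : ∀ k, B.coeff k = m (q k) := fun _ => rfl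
  have hp1 : p 1 = a := (comp_congr rfl hax.symm _).trans (comp_src a)
  have hrq : ∀ k l : c.IsotropyKernel x, rng (q l) = rng k.1 := fun k l =>
    (rng_comp _ _ _).trans (l.2.2.1.trans k.2.2.1.symm)
  -- The factorisations of `k` that contribute to `(m * n) k` are the pairs `(l a⁻¹, a l⁻¹ k)` with
  -- `l` in the isotropy group, since the points of the support of `m` with
  -- range `x` have source `rng a`.
  have hBA : ∀ k, (B * A).coeff k = (m * n) k.1 := by
    intro k
    let e : c.IsotropyKernel x → Composable H := fun l =>
      ⟨(q l, comp (inv (q l)) k.1 ((src_inv _).trans (hrq k l))),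
        (rng_inv _).symm.trans (rng_comp _ _ _).symm⟩
    have he : Function.Injective e := fun l l' hl =>
      hq (congrArg (fun t : Composable H => t.1.1) hl)
    have hpe : ∀ l, p (l⁻¹ * k) = (e l).1.2 := by
      intro l
      show comp a (comp (inv l.1) k.1 _) _ = comp (inv (comp l.1 (inv a) _)) k.1 _
      rw [← comp_assoc a (inv l.1) k.1
        ((rng_inv l.1).trans (l.2.1.trans hax.symm)).symm
        ((src_inv l.1).trans (l.2.2.1.trans k.2.2.1.symm))]
      refine comp_congr ?_ rfl _
      rw [inv_comp_rev]
      exact (comp_congr (inv_inv' a) rfl _).symm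
    have h1 : (B * A).coeff k = ∑ᶠ l, m (e l).1.1 * n (e l).1.2 := by
      rw [MonoidAlgebra.coeff_mul_apply_left, Finsupp.sum]
      refine (finsum_eq_sum_of_support_subset _ ?_).symm.trans (finsum_congr fun l => ?_)
      · intro l hl
        exact Finsupp.mem_support_iff.mpr (left_ne_zero_of_mul hl)
      · rw [hA, hB, hpe]
    rw [h1, mul_apply, ← finsum_mem_range (f := fun t : Composable H => m t.1.1 * n t.1.2) he]
    refine finsum_mem_inter_support_eq' _ _ _ fun t ht => ⟨?_, fun htk => ?_⟩
    · rintro ⟨l, rfl⟩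
      exact comp_inv_cancel (q l) k.1 (hrq k l)
    · obtain ⟨⟨α, β⟩, hαβ⟩ := t
      have htk' : comp α β hαβ = k.1 := htk
      have hα : m α ≠ 0 := left_ne_zero_of_mul ht
      have hrα : rng α = x := by rw [← rng_comp α β hαβ, htk', k.2.2.1]
      obtain ⟨b', hb', hmb', hsb'⟩ := h.exists_inv_ne_zero ha
      have hsα : src α = rng a := by
        rw [h.symm.src_eq_of_rng_eq hα hmb' (by rw [hrα, rng_inv, hsb', hax]), src_inv,
          h.rng_eq_of_src_eq hb' ha hsb']
      have hcα : c.toFun α = g⁻¹ := hm hα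
      let l : c.IsotropyKernel x := ⟨comp α a hsα, (src_comp _ _ _).trans hax,
        (rng_comp _ _ _).trans hrα, by rw [c.map_comp, hcα, hca, inv_mul_cancel]⟩
      have hql : q l = α := by
        show comp (comp α a hsα) (inv a) _ = α
        rw [comp_assoc α a (inv a) hsα (rng_inv a).symm, comp_congr rfl (comp_inv a),
          comp_congr rfl hsα.symm, comp_src]
      refine ⟨l, Subtype.ext (Prod.ext hql ?_)⟩
      show comp (inv (q l)) k.1 _ = β
      rw [comp_congr (congrArg inv hql) htk'.symm, inv_comp_cancel]
  have hone : B * A = 1 := by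
    refine MonoidAlgebra.ext (Finsupp.ext fun k => ?_)
    rw [hBA, MonoidAlgebra.one_def, MonoidAlgebra.coeff_single]
    by_cases hk : k = 1
    · subst hk
      rw [Finsupp.single_eq_same]
      show (m * n) x.1 = 1
      rw [← hax, h.mul_apply_src ha]
    · rw [Finsupp.single_eq_of_ne hk]
      refine apply_eq_zero_of_mem_diagonal h.symm.mul_mem_diagonal fun hku => hk (Subtype.ext ?_)
      rw [← mem_units_iff_rng.mp hku]
      exact k.2.2.1
  have hA1 : A.coeff 1 ≠ 0 := by rw [hA, hp1]; exact ha
  -- a one-sided inverse is two-sided, as there are no zero-divisors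
  have := hx.1
  obtain ⟨u, l, hl⟩ := hx.2 A (IsUnit.of_mul_eq_one_right B hone)
  have hrab : rng a = rng b := h.rng_eq_of_src_eq ha hb (hax.trans hbx.symm)
  let k : c.IsotropyKernel x :=
    ⟨comp (inv a) b ((src_inv a).trans hrab), (src_comp _ _ _).trans hbx,
      (rng_comp _ _ _).trans ((rng_inv a).trans hax), by
      rw [c.map_comp, c.map_inv, hca, hcb, inv_mul_cancel]⟩
  have hpk : p k = b := comp_inv_cancel a b hrab
  have hAk : A.coeff k ≠ 0 := by rw [hA, hpk]; exact hb
  have hsingle : ∀ k, A.coeff k ≠ 0 → k = l := fun k hk => by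
    by_contra hkl
    rw [hl, MonoidAlgebra.coeff_single, Finsupp.single_eq_of_ne hkl] at hk
    exact hk rfl
  rw [← hp1, ← hpk, hsingle _ hA1, hsingle _ hAk]

/-- The support of a normalizer is a bisection. Two points of the support with the same source would
have neighbourhoods, within the support, whose sources overlap in an open set, hence also over a
unit whose isotropy has a good group ring. -/
theorem isBisection_support (h : IsNormalizerPair c n m) (hc : InClass R c) :
    IsBisection (Function.support (n : H → R)) := by
  have := IsHausdorffGroupoid.t2 (G := H)
  obtain ⟨X, hX, hgood⟩ := hc
  have hsrc : Set.InjOn src (Function.support (n : H → R)) := by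
    intro a ha b hb hab
    by_contra hne
    obtain ⟨U, V, hU, hV, haU, hbV, hUV⟩ := t2_separation hne
    have hO : ∀ W : Set H, IsOpen W → IsOpen
        (srcUnit '' (W ∩ Function.support (n : H → R))) := fun W hW =>
      (IsEtaleGroupoid.src_localHomeo (G := H)).isOpenMap _ (hW.inter n.isOpen_support)
    obtain ⟨x, ⟨⟨a', ha', ea⟩, ⟨b', hb', eb⟩⟩, hx⟩ := hX.inter_open_nonempty _
      ((hO U hU).inter (hO V hV))
      ⟨srcUnit a, ⟨a, ⟨haU, ha⟩, rfl⟩, ⟨b, ⟨hbV, hb⟩, Subtype.ext hab.symm⟩⟩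
    have hab' : a' = b' := h.eq_of_src_eq_of_good (hgood x hx) ha'.2 hb'.2
      (congrArg Subtype.val ea) (congrArg Subtype.val eb)
    exact Set.disjoint_left.mp hUV ha'.1 (hab' ▸ hb'.1)
  exact ⟨hsrc, fun a ha b hb hab => hsrc ha hb (h.src_eq_of_rng_eq ha hb hab)⟩

theorem inv_ne_zero (h : IsNormalizerPair c n m) (hc : InClass R c) {a : H} (ha : n a ≠ 0) :
    m (inv a) ≠ 0 := by
  obtain ⟨b, hb, hmb, hab⟩ := h.exists_inv_ne_zero ha
  rwa [← (h.isBisection_support hc).1 hb ha hab]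

/-- Inclusion of the supports of two normalizers is an algebraic relation. -/
theorem support_subset_iff {n' m' : Steinberg R H} (h : IsNormalizerPair c n m)
    (h' : IsNormalizerPair c n' m') (hc : InClass R c) :
    Function.support (n : H → R) ⊆ Function.support (n' : H → R) ↔
      ∃ d ∈ diagonal R H, n = n' * d := by
  constructor
  · intro hs
    -- `m' * n` lies in the diagonal, as a product of an inverse and a point of one bisection
    refine ⟨m' * n, ?_, ?_⟩
    · intro y hy
      obtain ⟨α, β, hαβ, rfl, hα, hβ⟩ := exists_of_mul_apply_ne_zero hy
      have hα' := h'.symm.inv_ne_zero hc hα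
      have e := (h'.isBisection_support hc).2 hα' (hs hβ) (by rw [rng_inv, hαβ])
      rw [comp_congr rfl e.symm, comp_inv]
      exact rng_mem_units α
    · refine Steinberg.ext fun y => ?_
      rw [← mul_assoc, diag_mul_apply h'.mul_mem_diagonal]
      by_cases hy : n y = 0
      · rw [hy, mul_zero]
      · rw [h'.mul_apply_rng (hs hy), one_mul]
  · rintro ⟨d, hd, rfl⟩ y hy
    rw [Function.mem_support, mul_diag_apply hd] at hy
    exact left_ne_zero_of_mul hy

/-- The convolution of two normalizers does not vanish at the product of two points of their
supports. -/
theorem mul_apply_ne_zero (h : IsNormalizerPair c n m) (hc : InClass R c) {f : Steinberg R H}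
    {a b : H} (ha : n a ≠ 0) (hb : f b ≠ 0) (hab : src a = rng b) :
    (n * f) (comp a b hab) ≠ 0 := by
  rw [mul_apply_comp hab fun a' b' h' e ha' _ => (h.isBisection_support hc).2 ha' ha (by
    rw [← rng_comp a' b' h', e, rng_comp])]
  exact mul_ne_zero ha hb

end IsNormalizerPair

end Support

/-! ### Spaces with isomorphic bases of compact open sets -/

section Basis

variable {ι X Y : Type*} [TopologicalSpace X] [TopologicalSpace Y] [T2Space Y]
  {U : ι → Set X} {V : ι → Set Y}

/-- The sets `V i` for which `U i` is a neighbourhood of `x` form a directed family of nonempty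
compact sets, so they have a common point. -/
theorem exists_forall_mem_of_basis (hV : ∀ i, IsCompact (V i)) (hU : ∀ i, IsOpen (U i))
    (hUb : ∀ (O : Set X), IsOpen O → ∀ x ∈ O, ∃ i, x ∈ U i ∧ U i ⊆ O)
    (hsub : ∀ i j, U i ⊆ U j → V i ⊆ V j) (hne : ∀ i, (U i).Nonempty → (V i).Nonempty) (x : X) :
    ∃ y, ∀ i, x ∈ U i → y ∈ V i := by
  obtain ⟨i₀, hi₀, -⟩ := hUb Set.univ isOpen_univ x trivial
  have : Nonempty {i // x ∈ U i} := ⟨⟨i₀, hi₀⟩⟩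
  obtain ⟨y, hy⟩ := IsCompact.nonempty_iInter_of_directed_nonempty_isCompact_isClosed
    (fun i : {i // x ∈ U i} => V i) (fun i j => by
      obtain ⟨k, hk, hkij⟩ := hUb _ ((hU i).inter (hU j)) x ⟨i.2, j.2⟩
      exact ⟨⟨k, hk⟩, hsub _ _ fun z hz => (hkij hz).1, hsub _ _ fun z hz => (hkij hz).2⟩)
    (fun i => hne _ ⟨x, i.2⟩) (fun i => hV i) fun i => (hV i).isClosed
  exact ⟨y, fun i hi => Set.mem_iInter.mp hy ⟨i, hi⟩⟩

variable [T2Space X]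

theorem eq_of_forall_mem_of_basis
    (hUb : ∀ (O : Set X), IsOpen O → ∀ x ∈ O, ∃ i, x ∈ U i ∧ U i ⊆ O) {x x' : X}
    (h : ∀ i, x ∈ U i → x' ∈ U i) : x' = x := by
  by_contra hne
  obtain ⟨i, hi, hi'⟩ := hUb {x'}ᶜ isOpen_compl_singleton x (Ne.symm hne)
  exact hi' (h i hi) rfl

theorem exists_mem_iff_of_basis (hUc : ∀ i, IsCompact (U i)) (hVc : ∀ i, IsCompact (V i))
    (hU : ∀ i, IsOpen (U i)) (hV : ∀ i, IsOpen (V i))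
    (hUb : ∀ (O : Set X), IsOpen O → ∀ x ∈ O, ∃ i, x ∈ U i ∧ U i ⊆ O)
    (hVb : ∀ (O : Set Y), IsOpen O → ∀ y ∈ O, ∃ i, y ∈ V i ∧ V i ⊆ O)
    (hsub : ∀ i j, U i ⊆ U j ↔ V i ⊆ V j) (hne : ∀ i, (U i).Nonempty ↔ (V i).Nonempty) (x : X) :
    ∃ y, ∀ i, y ∈ V i ↔ x ∈ U i := by
  obtain ⟨y, hy⟩ := exists_forall_mem_of_basis hVc hU hUb (fun i j => (hsub i j).mp)
    (fun i => (hne i).mp) x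
  obtain ⟨x', hx'⟩ := exists_forall_mem_of_basis hUc hV hVb (fun i j => (hsub i j).mpr)
    (fun i => (hne i).mpr) y
  obtain rfl := eq_of_forall_mem_of_basis hUb fun i hi => hx' i (hy i hi)
  exact ⟨y, fun i => ⟨hx' i, hy i⟩⟩

/-- Two Hausdorff spaces with bases of compact open sets that are isomorphic as partially ordered
sets are homeomorphic. Compactness provides a point common to the sets that correspond to the
neighbourhoods of a given point. -/
theorem exists_homeomorph_of_basis (hUc : ∀ i, IsCompact (U i)) (hVc : ∀ i, IsCompact (V i))
    (hU : ∀ i, IsOpen (U i)) (hV : ∀ i, IsOpen (V i))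
    (hUb : ∀ (O : Set X), IsOpen O → ∀ x ∈ O, ∃ i, x ∈ U i ∧ U i ⊆ O)
    (hVb : ∀ (O : Set Y), IsOpen O → ∀ y ∈ O, ∃ i, y ∈ V i ∧ V i ⊆ O)
    (hsub : ∀ i j, U i ⊆ U j ↔ V i ⊆ V j) (hne : ∀ i, (U i).Nonempty ↔ (V i).Nonempty) :
    ∃ ψ : X ≃ₜ Y, ∀ x i, ψ x ∈ V i ↔ x ∈ U i := by
  choose f hf using exists_mem_iff_of_basis hUc hVc hU hV hUb hVb hsub hne
  choose g hg using exists_mem_iff_of_basis hVc hUc hV hU hVb hUb (fun i j => (hsub i j).symm)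
    fun i => (hne i).symm
  refine ⟨⟨⟨f, g, fun x => ?_, fun y => ?_⟩, ?_, ?_⟩, hf⟩
  · exact eq_of_forall_mem_of_basis hUb fun i hi => (hg _ i).mpr ((hf x i).mpr hi)
  · exact eq_of_forall_mem_of_basis hVb fun i hi => (hf _ i).mpr ((hg y i).mpr hi)
  · refine continuous_iff_continuousAt.mpr fun x O hO => Filter.mem_map.mpr ?_
    obtain ⟨O', hO', hO'o, hx⟩ := mem_nhds_iff.mp hO
    obtain ⟨i, hi, hiO⟩ := hVb O' hO'o _ hx
    filter_upwards [(hU i).mem_nhds ((hf x i).mp hi)] with z hz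
    exact hO' (hiO ((hf z i).mpr hz))
  · refine continuous_iff_continuousAt.mpr fun y O hO => Filter.mem_map.mpr ?_
    obtain ⟨O', hO', hO'o, hy⟩ := mem_nhds_iff.mp hO
    obtain ⟨i, hi, hiO⟩ := hUb O' hO'o _ hy
    filter_upwards [(hV i).mem_nhds ((hg y i).mp hi)] with z hz
    exact hO' (hiO ((hg z i).mpr hz))

end Basis

/-! ### Reconstruction of the groupoid -/

section Reconstruction

variable {R H₁ H₂ Γ : Type*} [CommRing R] [GroupoidStr H₁] [TopologicalSpace H₁]
  [IsAmpleGroupoid H₁] [GroupoidStr H₂] [TopologicalSpace H₂] [IsAmpleGroupoid H₂] [Group Γ]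
  [TopologicalSpace Γ]

open Steinberg

theorem IsNormalizerPair.map {c₁ : ContCocycle H₁ Γ} {c₂ : ContCocycle H₂ Γ}
    {φ : Steinberg R H₁ ≃+* Steinberg R H₂}
    (hD : ∀ f, φ f ∈ diagonal R H₂ ↔ f ∈ diagonal R H₁)
    (hg : ∀ g f, φ f ∈ SteinbergStable.homogeneous R c₂ g ↔
      f ∈ SteinbergStable.homogeneous R c₁ g) {n m : Steinberg R H₁}
    (h : IsNormalizerPair c₁ n m) : IsNormalizerPair c₂ (φ n) (φ m) where
  homogeneous := let ⟨g, hn, hm⟩ := h.homogeneous; ⟨g, (hg _ _).mpr hn, (hg _ _).mpr hm⟩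
  mul_mul_left := by rw [← map_mul, ← map_mul, h.mul_mul_left]
  mul_mul_right := by rw [← map_mul, ← map_mul, h.mul_mul_right]
  conj_left d hd := by
    obtain ⟨d, rfl⟩ := φ.surjective d
    rw [← map_mul, ← map_mul, hD]
    exact h.conj_left d ((hD d).mp hd)
  conj_right d hd := by
    obtain ⟨d, rfl⟩ := φ.surjective d
    rw [← map_mul, ← map_mul, hD]
    exact h.conj_right d ((hD d).mp hd)

theorem Steinberg.support_nonempty_iff {f : Steinberg R H₁} :
    (Function.support (f : H₁ → R)).Nonempty ↔ f ≠ 0 := by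
  rw [Function.support_nonempty_iff]
  exact not_congr ⟨fun h => Subtype.ext h, fun h => congrArg Subtype.val h⟩

variable [IsDomain R] [DiscreteTopology Γ]

/-- A graded ring isomorphism that preserves the diagonal induces a homeomorphism that is compatible
with the supports of normalizers, because it maps normalizers to normalizers and preserves the
inclusion of their supports. -/
theorem exists_homeomorph_of_ringEquiv {c₁ : ContCocycle H₁ Γ} {c₂ : ContCocycle H₂ Γ}
    (h₁ : InClass R c₁) (h₂ : InClass R c₂) {φ : Steinberg R H₁ ≃+* Steinberg R H₂}
    (hD : ∀ f, φ f ∈ diagonal R H₂ ↔ f ∈ diagonal R H₁)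
    (hg : ∀ g f, φ f ∈ homogeneous R c₂ g ↔ f ∈ homogeneous R c₁ g) :
    ∃ ψ : H₁ ≃ₜ H₂, ∀ n m, IsNormalizerPair c₁ n m → ∀ a, φ n (ψ a) ≠ 0 ↔ n a ≠ 0 := by
  have := IsHausdorffGroupoid.t2 (G := H₁)
  have := IsHausdorffGroupoid.t2 (G := H₂)
  let ι := {n : Steinberg R H₁ // ∃ m, IsNormalizerPair c₁ n m}
  refine (exists_homeomorph_of_basis (ι := ι)
    (U := fun n => Function.support (n.1 : H₁ → R))
    (V := fun n => Function.support (φ n.1 : H₂ → R))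
    (fun n => n.1.2.2) (fun n => (φ n.1).2.2) (fun n => n.1.isOpen_support)
    (fun n => (φ n.1).isOpen_support) ?_ ?_ ?_ ?_).imp fun ψ hψ n m h a => hψ a ⟨n, m, h⟩
  · intro O hO a ha
    obtain ⟨B, hB, hB', m, hm, haB, hBO⟩ := exists_isNormalizerPair_char (R := R) c₁ hO ha
    exact ⟨⟨_, m, hm⟩, by simp [char_of_mem hB hB' haB],
      (support_char_subset hB hB').trans hBO⟩
  · intro O hO a ha
    obtain ⟨B, hB, hB', m, hm, haB, hBO⟩ := exists_isNormalizerPair_char (R := R) c₂ hO ha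
    refine ⟨⟨φ.symm (char R B hB hB'), φ.symm m, IsNormalizerPair.map (φ := φ.symm)
      (fun f => ?_) (fun g f => ?_) hm⟩, ?_, ?_⟩
    · rw [← hD, φ.apply_symm_apply]
    · rw [← hg, φ.apply_symm_apply]
    · simp [char_of_mem hB hB' haB]
    · simp only [φ.apply_symm_apply]
      exact (support_char_subset hB hB').trans hBO
  · rintro ⟨n, m, h⟩ ⟨n', m', h'⟩
    rw [h.support_subset_iff h' h₁, (h.map hD hg).support_subset_iff (h'.map hD hg) h₂]
    constructor
    · rintro ⟨d, hd, rfl⟩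
      exact ⟨φ d, (hD d).mpr hd, map_mul φ _ _⟩
    · rintro ⟨d, hd, e⟩
      obtain ⟨d, rfl⟩ := φ.surjective d
      exact ⟨d, (hD d).mp hd, φ.injective (by rw [e, map_mul])⟩
  · intro n
    rw [support_nonempty_iff, support_nonempty_iff, ne_eq, ne_eq, EmbeddingLike.map_eq_zero_iff]

/-- The homeomorphism induced by a graded ring isomorphism that preserves the diagonal is an
isomorphism of groupoids and respects the cocycles. -/
theorem exists_groupoidIso_of_ringEquiv {c₁ : ContCocycle H₁ Γ} {c₂ : ContCocycle H₂ Γ}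
    (h₁ : InClass R c₁) (h₂ : InClass R c₂) (φ : Steinberg R H₁ ≃+* Steinberg R H₂)
    (hD : ∀ f, φ f ∈ diagonal R H₂ ↔ f ∈ diagonal R H₁)
    (hg : ∀ g f, φ f ∈ homogeneous R c₂ g ↔ f ∈ homogeneous R c₁ g) :
    ∃ ψ : GroupoidIso H₁ H₂, c₂.toFun ∘ ψ.toFun = c₁.toFun := by
  have := IsHausdorffGroupoid.t2 (G := H₁)
  obtain ⟨ψ, hψ⟩ := exists_homeomorph_of_ringEquiv h₁ h₂ hD hg
  -- a normalizer that does not vanish at a given point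
  have hex : ∀ a : H₁, ∃ n m : Steinberg R H₁, IsNormalizerPair c₁ n m ∧ n a ≠ 0 := fun a => by
    obtain ⟨B, hB, hB', m, hm, haB, -⟩ :=
      exists_isNormalizerPair_char (R := R) c₁ isOpen_univ (a := a) trivial
    exact ⟨_, m, hm, by simp [char_of_mem hB hB' haB]⟩
  -- a unit is determined by the projections of the diagonal that do not vanish there
  have heq : ∀ x ∈ units H₁, ∀ y : H₂, (∀ n m, IsNormalizerPair c₁ n m → n ∈ diagonal R H₁ →
      n x ≠ 0 → φ n y ≠ 0) → ψ x = y := by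
    intro x hx y h
    obtain ⟨z, rfl⟩ := ψ.surjective y
    by_contra hne
    obtain ⟨B, hB, hB', m, hm, hxB, hBO⟩ := exists_isNormalizerPair_char (R := R) c₁
      (isOpen_units.inter (isOpen_compl_singleton (x := z))) ⟨hx, fun e => hne (by rw [e])⟩
    have := h _ m hm (char_mem_diagonal fun b hb => (hBO hb).1) (by simp [char_of_mem hB hB' hxB])
    rw [hψ _ m hm] at this
    exact (hBO (mem_of_char_ne_zero this)).2 rfl
  have hsrc : ∀ a, ψ (src a) = src (ψ a) := fun a => by
    refine heq _ (src_mem_units a) _ fun d e hde hd hda => ?_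
    obtain ⟨n, m, hn, hna⟩ := hex a
    have h : (n * d) a ≠ 0 := by rw [mul_diag_apply hd]; exact mul_ne_zero hna hda
    rw [← hψ _ _ (hn.mul hde), map_mul, mul_diag_apply ((hD d).mpr hd)] at h
    exact right_ne_zero_of_mul h
  have hrng : ∀ a, ψ (rng a) = rng (ψ a) := fun a => by
    refine heq _ (rng_mem_units a) _ fun d e hde hd hda => ?_
    obtain ⟨n, m, hn, hna⟩ := hex a
    have h : (d * n) a ≠ 0 := by rw [diag_mul_apply hd]; exact mul_ne_zero hda hna
    rw [← hψ _ _ (hde.mul hn), map_mul, diag_mul_apply ((hD d).mpr hd)] at h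
    exact left_ne_zero_of_mul h
  refine ⟨{ ψ with
    map_src := hsrc
    map_rng := hrng
    map_comp := fun a b hab => ?_ }, funext fun a => ?_⟩
  · obtain ⟨n, m, hn, hna⟩ := hex a
    obtain ⟨n', m', hn', hnb⟩ := hex b
    -- `φ n * φ n'` does not vanish at `ψ (ab)`, so this point factors through the supports of `φ n`
    -- and `φ n'`; as these are bisections, the factors are `ψ a` and `ψ b`
    have h := hn.mul_apply_ne_zero h₁ hna hnb hab
    rw [← hψ _ _ (hn.mul hn'), map_mul] at h
    obtain ⟨a', b', hab', e, ha', hb'⟩ := exists_of_mul_apply_ne_zero h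
    have ea : a' = ψ a := ((hn.map hD hg).isBisection_support h₂).2 ha' ((hψ _ _ hn a).mpr hna) (by
      rw [← rng_comp a' b' hab', e, ← hrng, ← hrng, rng_comp])
    have eb : b' = ψ b := ((hn'.map hD hg).isBisection_support h₂).1 hb' ((hψ _ _ hn' b).mpr hnb)
      (by rw [← src_comp a' b' hab', e, ← hsrc, ← hsrc, src_comp])
    exact e.symm.trans (comp_congr ea eb _)
  · obtain ⟨n, m, hn, hna⟩ := hex a
    obtain ⟨g, hng, -⟩ := hn.homogeneous
    exact (((hg g n).mpr hng) ((hψ _ _ hn a).mpr hna)).trans (hng hna).symm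

end Reconstruction

/-! ### The stabilised Steinberg algebra as a Steinberg algebra -/

section Stabilisation

variable {R G : Type*} [CommRing R] [TopologicalSpace G]

open Steinberg

instance : DecidableEq FullRel := inferInstanceAs (DecidableEq (ℕ × ℕ))

variable (R) in
/-- Finitely supported matrices as finitely supported functions on `ℛ`. -/
noncomputable def minftyEquivFinsupp : Minfty R ≃ₗ[R] (FullRel →₀ R) where
  toFun M := Finsupp.ofSupportFinite (fun ξ : FullRel => M ξ.1 ξ.2) M.2
  invFun f := ⟨fun i j => f (i, j), f.hasFiniteSupport⟩
  map_add' _ _ := Finsupp.ext fun _ => rfl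
  map_smul' _ _ := Finsupp.ext fun _ => rfl
  left_inv _ := rfl
  right_inv _ := Finsupp.ext fun _ => rfl

theorem minftyEquivFinsupp_apply (M : Minfty R) (ξ : FullRel) :
    minftyEquivFinsupp R M ξ = M ξ.1 ξ.2 := rfl

/-- The restriction of a function on `G × ℛ` to `G × {ξ}`. -/
def Steinberg.slice (f : Steinberg R (G × FullRel)) (ξ : FullRel) : Steinberg R G :=
  ⟨fun η => f (η, ξ), f.2.1.comp_continuous (by fun_prop), by
    have h : IsCompact (Function.support (f : G × FullRel → R) ∩ Prod.snd ⁻¹' {ξ}) :=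
      f.2.2.inter_right ((isClosed_discrete _).preimage continuous_snd)
    convert! h.image continuous_fst
    ext η
    constructor
    · intro hη
      exact ⟨(η, ξ), ⟨hη, rfl⟩, rfl⟩
    · rintro ⟨⟨_, _⟩, ⟨hη, rfl⟩, rfl⟩
      exact hη⟩

theorem Steinberg.finite_slice (f : Steinberg R (G × FullRel)) :
    (Function.support f.slice).Finite := by
  refine ((f.2.2.image continuous_snd).finite_of_discrete).subset fun ξ hξ => ?_
  by_contra hcon
  refine hξ (Steinberg.ext fun η => ?_)
  by_contra hne
  exact hcon ⟨(η, ξ), hne, rfl⟩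

variable (R G) in
/-- A finite family of elements of `A_R(G)` indexed by `ℛ` is an element of `A_R(G × ℛ)`. -/
noncomputable def finsuppEquivSteinberg :
    (FullRel →₀ Steinberg R G) ≃ₗ[R] Steinberg R (G × FullRel) where
  toFun F := ⟨fun p => F p.2 p.1, by
    have hl : IsLocallyConstant fun p : G × FullRel => F p.2 p.1 := by
      rw [IsLocallyConstant.iff_eventually_eq]
      rintro ⟨η, ξ⟩
      have h : ∀ᶠ q : FullRel in 𝓝 ξ, q = ξ := by rw [nhds_discrete]; exact rfl
      filter_upwards [((F ξ).2.1.eventually_eq η).prod_inl_nhds ξ, h.prod_inr_nhds η] with p h1 h2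
      rw [h2]
      exact h1
    refine ⟨hl, (F.support.finite_toSet.isCompact_biUnion fun ξ _ =>
      (F ξ).2.2.prod (isCompact_singleton (x := ξ))).of_isClosed_subset (isClosed_support hl) ?_⟩
    rintro ⟨η, ξ⟩ h
    refine Set.mem_biUnion (x := ξ) ?_ ⟨h, rfl⟩
    refine Finsupp.mem_support_iff.mpr fun h0 => h ?_
    show F ξ η = 0
    rw [h0]
    rfl⟩
  invFun f := Finsupp.ofSupportFinite f.slice f.finite_slice
  map_add' _ _ := rfl
  map_smul' _ _ := rfl
  left_inv _ := Finsupp.ext fun _ => rfl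
  right_inv _ := rfl

variable [GroupoidStr G]

variable (R G) in
/-- An element of `A_R(G) ⊗ M_∞(R)` as a finite family of elements of `A_R(G)`. -/
noncomputable def stableEquivFinsupp : StableAlg R G ≃ₗ[R] (FullRel →₀ Steinberg R G) :=
  TensorProduct.congr (LinearEquiv.refl R _) (minftyEquivFinsupp R) ≪≫ₗ
    TensorProduct.finsuppScalarRight R R (Steinberg R G) FullRel

theorem stableEquivFinsupp_tmul (f : Steinberg R G) (M : Minfty R) (ξ : FullRel) :
    stableEquivFinsupp R G (f ⊗ₜ M) ξ = M ξ.1 ξ.2 • f := by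
  simp [stableEquivFinsupp, TensorProduct.finsuppScalarRight_apply_tmul_apply,
    minftyEquivFinsupp_apply]

variable (R) in
/-- The matrix unit at a given position. -/
noncomputable def matrixUnit (ξ : FullRel) : Minfty R :=
  (minftyEquivFinsupp R).symm (Finsupp.single ξ 1)

theorem matrixUnit_mem_Dinfty {ξ : FullRel} (h : ξ.1 = ξ.2) : matrixUnit R ξ ∈ Dinfty R := by
  intro i j hij
  refine Finsupp.single_eq_of_ne ?_
  rintro rfl
  exact hij h

theorem stableEquivFinsupp_symm_single (ξ : FullRel) (f : Steinberg R G) :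
    (stableEquivFinsupp R G).symm (Finsupp.single ξ f) = f ⊗ₜ matrixUnit R ξ := by
  simp [stableEquivFinsupp, TensorProduct.finsuppScalarRight_symm_apply_single, matrixUnit]

/-- Membership in a submodule of the stabilised algebra can be checked on entries, since an element
is the sum of its entries times matrix units. -/
theorem mem_of_forall_entry_tmul_mem {S : Submodule R (StableAlg R G)} {x : StableAlg R G}
    (h : ∀ ξ, (stableEquivFinsupp R G x ξ) ⊗ₜ[R] matrixUnit R ξ ∈ S) : x ∈ S := by
  rw [← (stableEquivFinsupp R G).symm_apply_apply x,
    ← Finsupp.sum_single (stableEquivFinsupp R G x), Finsupp.sum, map_sum]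
  refine S.sum_mem fun ξ _ => ?_
  rw [stableEquivFinsupp_symm_single]
  exact h ξ

variable (R G) in
/-- The linear isomorphism `A_R(G) ⊗ M_∞(R) ≃ A_R(G × ℛ)`. -/
noncomputable def stableEquivLinear : StableAlg R G ≃ₗ[R] Steinberg R (G × FullRel) :=
  stableEquivFinsupp R G ≪≫ₗ finsuppEquivSteinberg R G

theorem stableEquivLinear_apply (x : StableAlg R G) (p : G × FullRel) :
    stableEquivLinear R G x p = stableEquivFinsupp R G x p.2 p.1 := rfl

theorem stableEquivLinear_tmul (f : Steinberg R G) (M : Minfty R) (p : G × FullRel) :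
    stableEquivLinear R G (f ⊗ₜ M) p = f p.1 * M p.2.1 p.2.2 := by
  rw [stableEquivLinear_apply, stableEquivFinsupp_tmul, Steinberg.smul_apply, mul_comm]

theorem stableEquivLinear_mem_diagonal {x : StableAlg R G} :
    stableEquivLinear R G x ∈ diagonal R (G × FullRel) ↔ x ∈ stableDiagonal R G := by
  constructor
  · intro h
    refine mem_of_forall_entry_tmul_mem fun ξ => ?_
    by_cases hξ : ξ.1 = ξ.2
    · have hd : stableEquivFinsupp R G x ξ ∈ diagonal R G := fun η hη =>
        (mem_units_prod.mp (@h (η, ξ) hη)).1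
      exact ⟨⟨_, hd⟩ ⊗ₜ ⟨_, matrixUnit_mem_Dinfty hξ⟩, TensorProduct.map_tmul _ _ _ _⟩
    · have h0 : stableEquivFinsupp R G x ξ = 0 := Steinberg.ext fun η => by
        by_contra hne
        exact hξ (mem_units_prod.mp (@h (η, ξ) hne)).2
      rw [h0, TensorProduct.zero_tmul]
      exact Submodule.zero_mem _
  · rintro ⟨t, rfl⟩
    induction t with
    | zero => rw [map_zero, map_zero]; exact Submodule.zero_mem _
    | add s t hs ht => rw [map_add, map_add]; exact Submodule.add_mem _ hs ht
    | tmul f M =>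
      rw [TensorProduct.map_tmul]
      intro p hp
      rw [Function.mem_support, stableEquivLinear_tmul] at hp
      refine mem_units_prod.mpr ⟨f.2 (left_ne_zero_of_mul hp), ?_⟩
      by_contra hne
      exact right_ne_zero_of_mul hp (M.2 _ _ hne)

theorem stableEquivLinear_mem_homogeneous {Γ : Type*} [Group Γ] [TopologicalSpace Γ]
    {c : ContCocycle G Γ} {g : Γ} {x : StableAlg R G} :
    stableEquivLinear R G x ∈ homogeneous R c.stab g ↔ x ∈ stableHomogeneous R c g := by
  constructor
  · intro h
    refine mem_of_forall_entry_tmul_mem fun ξ => ?_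
    have hd : stableEquivFinsupp R G x ξ ∈ homogeneous R c g := fun η hη => @h (η, ξ) hη
    exact ⟨⟨_, hd⟩ ⊗ₜ matrixUnit R ξ, TensorProduct.map_tmul _ _ _ _⟩
  · rintro ⟨t, rfl⟩
    induction t with
    | zero => rw [map_zero, map_zero]; exact Submodule.zero_mem _
    | add s t hs ht => rw [map_add, map_add]; exact Submodule.add_mem _ hs ht
    | tmul f M =>
      rw [TensorProduct.map_tmul]
      intro p hp
      rw [Function.mem_support, stableEquivLinear_tmul] at hp
      exact f.2 (left_ne_zero_of_mul hp)

theorem stableEquivLinear_mul [IsEtaleGroupoid G] (x y : StableAlg R G) :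
    stableEquivLinear R G (x * y) = stableEquivLinear R G x * stableEquivLinear R G y := by
  classical
  induction x using TensorProduct.induction_on with
  | zero => rw [zero_mul, map_zero, zero_mul]
  | add s t hs ht => rw [add_mul, map_add, map_add, add_mul, hs, ht]
  | tmul f M =>
    induction y using TensorProduct.induction_on with
    | zero => rw [mul_zero, map_zero, mul_zero]
    | add s t hs ht => rw [mul_add, map_add, map_add, mul_add, hs, ht]
    | tmul f' M' =>
      rw [Algebra.TensorProduct.tmul_mul_tmul]
      refine Steinberg.ext ?_
      rintro ⟨η, i, j⟩
      obtain ⟨n, hn⟩ := M.exists_bound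
      have hfin := finite_support f f' η
      let e : Composable G × ℕ → Composable (G × FullRel) := fun t =>
        ⟨((t.1.1.1, (i, t.2)), (t.1.1.2, (t.2, j))), Prod.ext t.1.2 rfl⟩
      have he : Function.Injective e := fun t t' h => Prod.ext
        (Subtype.ext (Prod.ext
          (congrArg (fun q : Composable (G × FullRel) => q.1.1.1) h)
          (congrArg (fun q : Composable (G × FullRel) => q.1.2.1) h)))
        (congrArg (fun q : Composable (G × FullRel) => q.1.1.2.2) h)
      -- the contributing factorisations of `(η, (i, j))` are the images under `e` of the pairs of a
      -- contributing factorisation of `η` and an index `k < n`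
      have hR : ∑ᶠ p ∈ {p : Composable (G × FullRel) | compPair p = (η, ((i, j) : FullRel))},
          stableEquivLinear R G (f ⊗ₜ M) p.1.1 * stableEquivLinear R G (f' ⊗ₜ M') p.1.2 =
          ∑ᶠ p ∈ e '' (hfin.toFinset ×ˢ Finset.range n : Finset _),
          stableEquivLinear R G (f ⊗ₜ M) p.1.1 * stableEquivLinear R G (f' ⊗ₜ M') p.1.2 := by
        refine finsum_mem_inter_support_eq' _ _ _ fun p hp => ⟨fun hpη => ?_, ?_⟩
        · obtain ⟨⟨⟨a, i', k⟩, ⟨b, k', j'⟩⟩, hab⟩ := p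
          rw [Function.mem_support, stableEquivLinear_tmul, stableEquivLinear_tmul] at hp
          obtain rfl : k = k' := congrArg (fun q : G × FullRel => q.2.1) hab
          obtain rfl : i' = i := congrArg (fun q : G × FullRel => q.2.1) hpη
          obtain rfl : j' = j := congrArg (fun q : G × FullRel => q.2.2) hpη
          have hk : k < n := by
            by_contra hk
            exact right_ne_zero_of_mul (left_ne_zero_of_mul hp) (hn _ _ (Or.inr (not_lt.mp hk)))
          refine ⟨(⟨(a, b), congrArg Prod.fst hab⟩, k), ?_, rfl⟩
          rw [Finset.mem_coe, Finset.mem_product, Set.Finite.mem_toFinset, Finset.mem_range]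
          exact ⟨⟨congrArg Prod.fst hpη, left_ne_zero_of_mul
            ((mul_mul_mul_comm _ _ _ _).symm.trans_ne hp)⟩, hk⟩
        · rintro ⟨t, ht, rfl⟩
          rw [Finset.mem_coe, Finset.mem_product, Set.Finite.mem_toFinset] at ht
          exact Prod.ext ht.1.1 rfl
      rw [stableEquivLinear_tmul, mul_apply]
      refine Eq.trans ?_ hR.symm
      show (∑ᶠ p ∈ {p : Composable G | compPair p = η}, f p.1.1 * f' p.1.2) *
        (∑ᶠ k, M i k * M' k j) = _
      rw [finsum_mem_image he.injOn, finsum_mem_coe_finset, Finset.sum_product,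
        Minfty.finsum_eq_range hn, finsum_mem_eq_sum _ hfin, Finset.sum_mul_sum]
      refine Finset.sum_congr rfl fun p _ => Finset.sum_congr rfl fun k _ => ?_
      rw [stableEquivLinear_tmul, stableEquivLinear_tmul]
      exact mul_mul_mul_comm _ _ _ _

theorem stableEquivLinear_star [StarRing R] [IsEtaleGroupoid G] (x : StableAlg R G) :
    stableEquivLinear R G (star x) = star (stableEquivLinear R G x) := by
  induction x using TensorProduct.induction_on with
  | zero => rw [star_zero, map_zero, star_zero]
  | add s t hs ht => rw [star_add, map_add, map_add, star_add, hs, ht]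
  | tmul f M =>
    rw [TensorProduct.star_tmul]
    refine Steinberg.ext fun p => ?_
    rw [star_apply, stableEquivLinear_tmul, stableEquivLinear_tmul, star_mul']
    rfl

variable (R G) in
/-- The isomorphism of *-algebras `A_R(G) ⊗ M_∞(R) ≃ A_R(G × ℛ)`. -/
noncomputable def stableEquiv [StarRing R] [IsEtaleGroupoid G] :
    StableAlg R G ≃⋆ₐ[R] Steinberg R (G × FullRel) where
  __ := stableEquivLinear R G
  map_mul' := stableEquivLinear_mul
  map_add' := map_add (stableEquivLinear R G)
  map_star' := stableEquivLinear_star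
  map_smul' := map_smul (stableEquivLinear R G)

end Stabilisation

/-! ### Isomorphisms of groupoids induce isomorphisms of Steinberg algebras -/

namespace GroupoidIso

variable {H₁ H₂ : Type*} [GroupoidStr H₁] [TopologicalSpace H₁] [GroupoidStr H₂]
  [TopologicalSpace H₂]

theorem map_inv (ψ : GroupoidIso H₁ H₂) (a : H₁) : ψ.toFun (inv a) = inv (ψ.toFun a) := by
  refine eq_inv_of_comp (by rw [← ψ.map_src, ← ψ.map_rng, rng_inv]) ?_
  rw [← ψ.map_comp a (inv a) (rng_inv a).symm, comp_inv, ψ.map_rng]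

/-- The inverse of an isomorphism of groupoids. -/
def symm (ψ : GroupoidIso H₁ H₂) : GroupoidIso H₂ H₁ :=
  have hsrc : ∀ a, ψ.toHomeomorph.symm (src a) = src (ψ.toHomeomorph.symm a) := fun a => by
    rw [ψ.toHomeomorph.symm_apply_eq]
    exact ((ψ.map_src _).trans (congrArg src (ψ.toHomeomorph.apply_symm_apply a))).symm
  have hrng : ∀ a, ψ.toHomeomorph.symm (rng a) = rng (ψ.toHomeomorph.symm a) := fun a => by
    rw [ψ.toHomeomorph.symm_apply_eq]
    exact ((ψ.map_rng _).trans (congrArg rng (ψ.toHomeomorph.apply_symm_apply a))).symm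
  { ψ.toHomeomorph.symm with
    map_src := hsrc
    map_rng := hrng
    map_comp := fun a b h => by
      refine (ψ.toHomeomorph.symm_apply_eq).mpr (Eq.symm ?_)
      refine (ψ.map_comp _ _ _).trans (comp_congr ?_ ?_ _)
      · exact ψ.toHomeomorph.apply_symm_apply a
      · exact ψ.toHomeomorph.apply_symm_apply b }

variable {R : Type*} [CommRing R]

/-- Composition with the inverse of an isomorphism of groupoids. -/
def mapSteinberg (ψ : GroupoidIso H₁ H₂) (f : Steinberg R H₁) : Steinberg R H₂ :=
  ⟨fun a => f (ψ.symm.toFun a), f.2.1.comp_continuous ψ.symm.continuous_toFun,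
    ψ.toHomeomorph.symm.isClosedEmbedding.isCompact_preimage f.2.2⟩

theorem mapSteinberg_apply (ψ : GroupoidIso H₁ H₂) (f : Steinberg R H₁) (a : H₂) :
    ψ.mapSteinberg f a = f (ψ.symm.toFun a) := rfl

theorem symm_toFun_toFun (ψ : GroupoidIso H₁ H₂) (a : H₁) : ψ.symm.toFun (ψ.toFun a) = a :=
  ψ.left_inv a

theorem toFun_symm_toFun (ψ : GroupoidIso H₁ H₂) (a : H₂) : ψ.toFun (ψ.symm.toFun a) = a :=
  ψ.right_inv a

theorem mapSteinberg_mul [IsEtaleGroupoid H₁] [IsEtaleGroupoid H₂] (ψ : GroupoidIso H₁ H₂)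
    (f g : Steinberg R H₁) : ψ.mapSteinberg (f * g) = ψ.mapSteinberg f * ψ.mapSteinberg g := by
  refine Steinberg.ext fun a => ?_
  rw [mapSteinberg_apply, Steinberg.mul_apply, Steinberg.mul_apply]
  have hcomp (p : Composable H₁) : src (ψ.toFun p.1.1) = rng (ψ.toFun p.1.2) := by
    rw [← ψ.map_src, p.2, ψ.map_rng]
  have hcomp' (p : Composable H₂) : src (ψ.symm.toFun p.1.1) = rng (ψ.symm.toFun p.1.2) := by
    rw [← ψ.symm.map_src, p.2, ψ.symm.map_rng]
  refine finsum_mem_eq_of_bijOn (fun p : Composable H₁ =>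
    (⟨(ψ.toFun p.1.1, ψ.toFun p.1.2), hcomp p⟩ : Composable H₂)) ⟨?_, ?_, ?_⟩ ?_
  · intro p hp
    have hp' : comp p.1.1 p.1.2 p.2 = ψ.symm.toFun a := hp
    exact (ψ.map_comp p.1.1 p.1.2 p.2).symm.trans (by rw [hp', toFun_symm_toFun])
  · intro p _ q _ h
    exact Subtype.ext (Prod.ext
      (ψ.injective (congrArg (fun t : Composable H₂ => t.1.1) h))
      (ψ.injective (congrArg (fun t : Composable H₂ => t.1.2) h)))
  · intro q hq
    have hq' : comp q.1.1 q.1.2 q.2 = a := hq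
    refine ⟨⟨(ψ.symm.toFun q.1.1, ψ.symm.toFun q.1.2), hcomp' q⟩, ?_, ?_⟩
    · exact (ψ.symm.map_comp q.1.1 q.1.2 q.2).symm.trans (by rw [hq'])
    · exact Subtype.ext (Prod.ext (ψ.toFun_symm_toFun _) (ψ.toFun_symm_toFun _))
  · intro p _
    show _ = f (ψ.symm.toFun (ψ.toFun p.1.1)) * g (ψ.symm.toFun (ψ.toFun p.1.2))
    rw [symm_toFun_toFun, symm_toFun_toFun]

/-- The isomorphism of *-algebras induced by an isomorphism of groupoids. -/
def steinbergEquiv [StarRing R] [IsEtaleGroupoid H₁] [IsEtaleGroupoid H₂]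
    (ψ : GroupoidIso H₁ H₂) : Steinberg R H₁ ≃⋆ₐ[R] Steinberg R H₂ where
  toFun := ψ.mapSteinberg
  invFun := ψ.symm.mapSteinberg
  left_inv f := Steinberg.ext fun a => congrArg f.1 (ψ.symm_toFun_toFun a)
  right_inv f := Steinberg.ext fun a => congrArg f.1 (ψ.toFun_symm_toFun a)
  map_mul' := ψ.mapSteinberg_mul
  map_add' _ _ := rfl
  map_star' f := Steinberg.ext fun a => by
    show star (f (inv (ψ.symm.toFun a))) = star (f (ψ.symm.toFun (inv a)))
    rw [ψ.symm.map_inv]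
  map_smul' _ _ := rfl

theorem mapSteinberg_mem_diagonal (ψ : GroupoidIso H₁ H₂) {f : Steinberg R H₁}
    (hf : f ∈ diagonal R H₁) : ψ.mapSteinberg f ∈ diagonal R H₂ := fun a ha => by
  have h := mem_units_iff_rng.mp (hf ha)
  rw [← ψ.symm.map_rng] at h
  exact mem_units_iff_rng.mpr (ψ.symm.injective h)

theorem mapSteinberg_mem_homogeneous {Γ : Type*} [Group Γ] [TopologicalSpace Γ]
    {c₁ : ContCocycle H₁ Γ} {c₂ : ContCocycle H₂ Γ} (ψ : GroupoidIso H₁ H₂)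
    (hψ : c₂.toFun ∘ ψ.toFun = c₁.toFun) {g : Γ} {f : Steinberg R H₁}
    (hf : f ∈ homogeneous R c₁ g) : ψ.mapSteinberg f ∈ homogeneous R c₂ g := fun a ha => by
  have h : c₁.toFun (ψ.symm.toFun a) = g := hf ha
  rwa [← hψ, Function.comp_apply, toFun_symm_toFun] at h

end GroupoidIso

/-! ### Passing between `A_R(G) ⊗ M_∞(R)` and `A_R(G × ℛ)` -/

section Transfer

variable {R G₁ G₂ Γ : Type*} [CommRing R] [GroupoidStr G₁] [TopologicalSpace G₁]
  [IsEtaleGroupoid G₁] [GroupoidStr G₂] [TopologicalSpace G₂] [IsEtaleGroupoid G₂]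
  [Group Γ] [TopologicalSpace Γ] {c₁ : ContCocycle G₁ Γ} {c₂ : ContCocycle G₂ Γ}

variable [StarRing R]

theorem stableEquiv_mem_diagonal {x : StableAlg R G₁} :
    stableEquiv R G₁ x ∈ diagonal R (G₁ × FullRel) ↔ x ∈ stableDiagonal R G₁ :=
  stableEquivLinear_mem_diagonal

theorem stableEquiv_mem_homogeneous {g : Γ} {x : StableAlg R G₁} :
    stableEquiv R G₁ x ∈ homogeneous R c₁.stab g ↔ x ∈ stableHomogeneous R c₁ g :=
  stableEquivLinear_mem_homogeneous

/-- An isomorphism of the stabilised groupoids that respects the cocycles induces a graded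
isomorphism of the stabilised algebras that preserves the diagonal. -/
theorem exists_starAlgEquiv_of_groupoidIso (ψ : GroupoidIso (G₁ × FullRel) (G₂ × FullRel))
    (hψ : c₂.stab.toFun ∘ ψ.toFun = c₁.stab.toFun) :
    ∃ φ : StableAlg R G₁ ≃⋆ₐ[R] StableAlg R G₂, DiagonalPreserving R φ ∧ Graded R c₁ c₂ φ := by
  have hψ' : c₁.stab.toFun ∘ ψ.symm.toFun = c₂.stab.toFun := by
    rw [← hψ]
    exact funext fun a => congrArg c₂.stab.toFun (ψ.toFun_symm_toFun a)
  let φ : StableAlg R G₁ ≃⋆ₐ[R] StableAlg R G₂ :=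
    ((stableEquiv R G₁).trans ψ.steinbergEquiv).trans (stableEquiv R G₂).symm
  have hφ (x : StableAlg R G₁) :
      stableEquiv R G₂ (φ x) = ψ.mapSteinberg (stableEquiv R G₁ x) :=
    (stableEquiv R G₂).apply_symm_apply _
  have hφ' (y : StableAlg R G₂) :
      stableEquiv R G₁ (φ.symm y) = ψ.symm.mapSteinberg (stableEquiv R G₂ y) :=
    (stableEquiv R G₁).apply_symm_apply _
  refine ⟨φ, Set.Subset.antisymm ?_ fun y hy => ?_, fun g => Set.Subset.antisymm ?_ fun y hy => ?_⟩
  · rintro _ ⟨x, hx, rfl⟩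
    refine stableEquiv_mem_diagonal.mp ?_
    rw [hφ]
    exact ψ.mapSteinberg_mem_diagonal (stableEquiv_mem_diagonal.mpr hx)
  · refine ⟨φ.symm y, stableEquiv_mem_diagonal.mp ?_, φ.apply_symm_apply y⟩
    rw [hφ']
    exact ψ.symm.mapSteinberg_mem_diagonal (stableEquiv_mem_diagonal.mpr hy)
  · rintro _ ⟨x, hx, rfl⟩
    refine stableEquiv_mem_homogeneous.mp ?_
    rw [hφ]
    exact ψ.mapSteinberg_mem_homogeneous hψ (stableEquiv_mem_homogeneous.mpr hx)
  · refine ⟨φ.symm y, stableEquiv_mem_homogeneous.mp ?_, φ.apply_symm_apply y⟩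
    rw [hφ']
    exact ψ.symm.mapSteinberg_mem_homogeneous hψ' (stableEquiv_mem_homogeneous.mpr hy)

end Transfer

theorem exists_groupoidIso_of_stable_ringEquiv {R G₁ G₂ Γ : Type*} [CommRing R] [IsDomain R]
    [StarRing R] [GroupoidStr G₁] [TopologicalSpace G₁] [IsAmpleGroupoid G₁] [GroupoidStr G₂]
    [TopologicalSpace G₂] [IsAmpleGroupoid G₂] [Group Γ] [TopologicalSpace Γ] [DiscreteTopology Γ]
    {c₁ : ContCocycle G₁ Γ} {c₂ : ContCocycle G₂ Γ} (h₁ : InClass R c₁) (h₂ : InClass R c₂)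
    (φ : StableAlg R G₁ ≃+* StableAlg R G₂) (hD : DiagonalPreserving R φ)
    (hg : Graded R c₁ c₂ φ) :
    ∃ ψ : GroupoidIso (G₁ × FullRel) (G₂ × FullRel), c₂.stab.toFun ∘ ψ.toFun = c₁.stab.toFun := by
  have hD' (x : StableAlg R G₁) : φ x ∈ stableDiagonal R G₂ ↔ x ∈ stableDiagonal R G₁ := by
    rw [← SetLike.mem_coe, ← hD]
    exact φ.injective.mem_set_image
  have hg' (g : Γ) (x : StableAlg R G₁) :
      φ x ∈ stableHomogeneous R c₂ g ↔ x ∈ stableHomogeneous R c₁ g := by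
    rw [← SetLike.mem_coe, ← hg g]
    exact φ.injective.mem_set_image
  let Θ₁ := stableEquiv R G₁
  refine exists_groupoidIso_of_ringEquiv h₁.stab h₂.stab
    ((Θ₁.toRingEquiv.symm.trans φ).trans (stableEquiv R G₂).toRingEquiv) (fun f => ?_) fun g f => ?_
  · refine stableEquiv_mem_diagonal.trans ((hD' _).trans ?_)
    rw [← stableEquiv_mem_diagonal]
    exact iff_of_eq (congrArg (· ∈ _) (Θ₁.apply_symm_apply f))
  · refine stableEquiv_mem_homogeneous.trans ((hg' g _).trans ?_)
    rw [← stableEquiv_mem_homogeneous]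
    exact iff_of_eq (congrArg (· ∈ _) (Θ₁.apply_symm_apply f))

end SteinbergStable

theorem mainTheorem4
    {R : Type*} [CommRing R] [IsDomain R] [StarRing R]
    {Γ : Type*} [Group Γ] [TopologicalSpace Γ] [DiscreteTopology Γ]
    {G₁ : Type*} [SteinbergStable.GroupoidStr G₁] [TopologicalSpace G₁]
    [SteinbergStable.IsAmpleGroupoid G₁]
    {G₂ : Type*} [SteinbergStable.GroupoidStr G₂] [TopologicalSpace G₂]
    [SteinbergStable.IsAmpleGroupoid G₂]
    (c₁ : SteinbergStable.ContCocycle G₁ Γ) (c₂ : SteinbergStable.ContCocycle G₂ Γ)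
    (h₁ : SteinbergStable.InClass R c₁) (h₂ : SteinbergStable.InClass R c₂) :
    List.TFAE [
      ∃ ψ : SteinbergStable.GroupoidIso (G₁ × SteinbergStable.FullRel)
          (G₂ × SteinbergStable.FullRel),
        c₂.stab.toFun ∘ ψ.toFun = c₁.stab.toFun,
      ∃ φ : SteinbergStable.StableAlg R G₁ ≃⋆ₐ[R] SteinbergStable.StableAlg R G₂,
        SteinbergStable.DiagonalPreserving R φ ∧ SteinbergStable.Graded R c₁ c₂ φ,
      ∃ φ : SteinbergStable.StableAlg R G₁ ≃+* SteinbergStable.StableAlg R G₂,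
        SteinbergStable.DiagonalPreserving R φ ∧ SteinbergStable.Graded R c₁ c₂ φ] := by
  tfae_have 1 → 2 := fun ⟨ψ, hψ⟩ => SteinbergStable.exists_starAlgEquiv_of_groupoidIso ψ hψ
  tfae_have 2 → 3 := fun ⟨φ, hD, hg⟩ => ⟨φ.toRingEquiv, hD, hg⟩
  tfae_have 3 → 1 := fun ⟨φ, hD, hg⟩ =>
    SteinbergStable.exists_groupoidIso_of_stable_ringEquiv h₁ h₂ φ hD hg
  tfae_finish
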